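/- All rings are commutative and Noetherian with identity. A ring $A$ satisfies (SAC) if, for every finitely generated $A$-module $M$ such that $\operatorname{Ext}_A^i(M,A)=0$ for all $i>0$ and $\operatorname{Ext}_A^i(M,M)=0$ for all sufficiently large $i$, one has $\operatorname{Ext}_A^i(M,M)=0$ for all $i>0$. An $\mathfrak m$-primary ideal $I$ of a Cohen–Macaulay local ring $(R,\mathfrak m)$ is called an Ulrich ideal if $I^2=QI$ for some parameter ideal $Q\subseteq I$ (that is, an $\mathfrak m$-primary ideal generated by $\dim R$ elements) and $I/I^2$ is a free $R/I$-module. Let $\mu(I)$ denote the minimal number of generators of $I$. Theorem. Let $R$ be a Cohen–Macaulay local ring of dimension $n$, and let $I$ be an Ulrich ideal of $R$ such that $R/I$ is Gorenstein. (1) If $R/I$ satisfies (SAC) and $n\ge 2$, then $R/I^\ell$ satisfies (SAC) for all integers $\ell$ with $2\le \ell\le n$. (2) If $R/I^\ell$ satisfies (SAC) for some integer $\ell>0$ and $\mu(I)-\dim R>1$, then $R$ satisfies (SAC). -/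

import Mathlib

universe u

/-- The symmetric Auslander condition (SAC) for a commutative ring `R`: for every finitely generated
`R`-module `M`, if `Ext^i(M, R) = 0` for all `i > 0` and `Ext^i(M, M) = 0` for all large enough `i`,
then `Ext^i(M, M) = 0` for all `i > 0`. -/
def SatisfiesSAC (R : Type u) [CommRing R] : Prop :=
  ∀ (M : Type u) [AddCommGroup M] [Module R M] [Module.Finite R M],
    (∀ i : ℕ, 0 < i →
      Subsingleton (CategoryTheory.Abelian.Ext (ModuleCat.of R M) (ModuleCat.of R R) i)) →
    (∃ N : ℕ, ∀ i : ℕ, N < i →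
      Subsingleton (CategoryTheory.Abelian.Ext (ModuleCat.of R M) (ModuleCat.of R M) i)) →
    ∀ i : ℕ, 0 < i →
      Subsingleton (CategoryTheory.Abelian.Ext (ModuleCat.of R M) (ModuleCat.of R M) i)

/-- A Cohen-Macaulay local ring: a Noetherian local ring whose depth equals its Krull dimension,
i.e. one with a regular sequence (automatically inside the maximal ideal) of length `dim R`. -/
structure IsCohenMacaulayLocal (R : Type u) [CommRing R] : Prop where
  isLocalRing : IsLocalRing R
  isNoetherianRing : IsNoetherianRing R
  exists_isRegular : ∃ rs : List R,
    RingTheory.Sequence.IsRegular R rs ∧ ringKrullDim R = (rs.length : WithBot ℕ∞)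

/-- A Gorenstein local ring: a Noetherian local ring of finite injective dimension over itself. -/
structure IsGorensteinLocal (R : Type u) [CommRing R] : Prop where
  isLocalRing : IsLocalRing R
  isNoetherianRing : IsNoetherianRing R
  exists_hasInjectiveDimensionLE :
    ∃ d : ℕ, CategoryTheory.HasInjectiveDimensionLE (ModuleCat.of R R) d

/-- A parameter ideal of a Noetherian local ring `(R, 𝔪)`: an `𝔪`-primary ideal generated by
`dim R` elements (a system of parameters). -/
def IsParameterIdeal {R : Type u} [CommRing R] [IsLocalRing R] (Q : Ideal R) : Prop :=
  ∃ (d : ℕ) (x : Fin d → R), ringKrullDim R = (d : WithBot ℕ∞) ∧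
    Q = Ideal.span (Set.range x) ∧ Q.radical = IsLocalRing.maximalIdeal R

/-- Ulrich ideals of a (Cohen-Macaulay) local ring `(R, 𝔪)`: `𝔪`-primary ideals `I` with
`I ^ 2 = Q I` for some parameter ideal `Q ⊆ I` and `I / I ^ 2` free over `R / I`. -/
structure IsUlrichIdeal {R : Type u} [CommRing R] [IsLocalRing R] (I : Ideal R) : Prop where
  radical_eq : I.radical = IsLocalRing.maximalIdeal R
  exists_parameter : ∃ Q : Ideal R, IsParameterIdeal Q ∧ Q ≤ I ∧ I ^ 2 = Q * I
  free : Module.Free (R ⧸ I) I.Cotangent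

/-!
Let `B = R / I`, an Artinian Gorenstein local ring, hence self-injective, and let `Q ≤ I` be a
parameter ideal with `I ^ 2 = Q I`. Since `R` is Cohen–Macaulay, `Q` is generated by a regular
sequence of length `n` (`IsCohenMacaulayLocal.exists_isRegularOn`), so its powers have bases of
monomials (`exists_quasiregular_family`). The free `B`-module `Q / I ^ 2` is a direct summand of
`I / I ^ 2`, so `I / Q` is free, of some rank `r` (`exists_relBasis_parameter`). It follows that
every layer `I^j / I^{j+1}` is free over `B`, of explicit rank (`exists_relBasis_pow`).

The mechanism behind both halves is the following. If `Ext^i(M, B) = 0` for all `i > 0`, then, `B`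
being an injective cogenerator over itself, `M` is `Tor`-independent of `B` and hence of every
quotient built from copies of `B` (`IsResidueCogenerator.isPureAt`, `IsRelBasis.isPureAt`).
Consequently each layer of the `I`-adic filtration of `M` is a sum of copies of `M / I M`
(`IsRelBasis.isSES_layer`), and `Ext_R(M, -)` agrees with `Ext` over `R / I^l` of the base change
of `M`, as far as vanishing is concerned (`ext_baseChange_iff`).

To obtain `Ext^i(M, B) = 0` from `Ext^i(M, R) = 0` one compares lengths. Going down to
`R / I^l`, the extension of `B` by `B^r` given by `R / Q` yields `b_i = r b_{i+1}` for
`b_i = length Ext^i(M, B)`, and `r ≥ 2` forces `b_i = 0` (`IsSES.ext_eq_zero_of_two_le`). Over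
`C = R / I^l`, the bottom layer `I^{l-1} / I^l` has larger rank than all the other layers
together as soon as `l ≤ n` (`sum_layerRank_lt`, an inequality between binomials), so
`b_{i+1} < b_i` while `b_i ≠ 0`; the `b_i` vanish eventually, and `M` may be replaced by a high
syzygy, because `Ext^i(ΩM, ΩM) = Ext^i(M, M)` for `i > 0` whenever `Ext^j(M, R) = 0` for all
`j > 0` (`exists_syzygy`). The same two arguments applied to `length Ext^i(M, M / I M)` carry
the vanishing of `Ext^i(M, M)` for large `i` to the quotient ring. There (SAC) applies, and the
filtration, together with Nakayama's lemma along the regular sequence, carries the conclusion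
back (`SatisfiesSAC.of_quotient`, `SatisfiesSAC.of_quotient_pow`).
-/

open CategoryTheory Abelian TensorProduct

/-! ### Ext of modules: long exact sequences, dimension shifting, lengths -/

/-- The `R`-module `Ext^i_R(M, N)` for unbundled modules. -/
abbrev ModExt (R : Type u) [CommRing R] (M N : Type u) [AddCommGroup M] [Module R M]
    [AddCommGroup N] [Module R N] (i : ℕ) : Type u :=
  Ext (ModuleCat.of R M) (ModuleCat.of R N) i

/-- The sequence of modules `0 → X → Y → Z → 0` given by `f` and `g` is exact. -/
structure IsSES {R : Type u} [CommRing R] {X Y Z : Type u} [AddCommGroup X] [Module R X]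
    [AddCommGroup Y] [Module R Y] [AddCommGroup Z] [Module R Z]
    (f : X →ₗ[R] Y) (g : Y →ₗ[R] Z) : Prop where
  inj : Function.Injective f
  surj : Function.Surjective g
  exact : Function.Exact f g

section Toolkit

variable {R : Type u} [CommRing R] {M N X Y Z : Type u}
  [AddCommGroup M] [Module R M] [AddCommGroup N] [Module R N] [AddCommGroup X] [Module R X]
  [AddCommGroup Y] [Module R Y] [AddCommGroup Z] [Module R Z]
  {f : X →ₗ[R] Y} {g : Y →ₗ[R] Z}

theorem IsSES.shortExact (h : IsSES f g) :
    (ModuleCat.shortComplexOfCompEqZero f g h.exact.linearMap_comp_eq_zero).ShortExact :=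
  ModuleCat.shortComplex_shortExact _ h.exact h.inj h.surj

theorem IsSES.mkQ (K : Submodule R Y) : IsSES K.subtype K.mkQ :=
  ⟨K.injective_subtype, K.mkQ_surjective, LinearMap.exact_subtype_mkQ K⟩

theorem IsSES.ker {g : Y →ₗ[R] Z} (hg : Function.Surjective g) :
    IsSES (LinearMap.ker g).subtype g :=
  ⟨Submodule.injective_subtype _, hg, LinearMap.exact_subtype_ker_map g⟩

theorem IsSES.apply_apply (h : IsSES f g) (x : X) : g (f x) = 0 :=
  (h.exact (f x)).mpr ⟨x, rfl⟩

namespace ModExt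

theorem subsingleton_of_projective [Module.Projective R M] (N : Type u) [AddCommGroup N]
    [Module R N] (i : ℕ) : Subsingleton (ModExt R M N (i + 1)) :=
  have := ModuleCat.projective_of_categoryTheory_projective (R := R) (ModuleCat.of R M)
  Ext.subsingleton_of_projective _ _ _

theorem subsingleton_zero_iff {i : ℕ} : Subsingleton (ModExt R M N i) ↔ ∀ x : ModExt R M N i, x = 0 :=
  ⟨fun h x => h.elim _ _, fun h => ⟨fun x y => by rw [h x, h y]⟩⟩

theorem congr_right (e : N ≃ₗ[R] X) {i : ℕ} (h : Subsingleton (ModExt R M N i)) :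
    Subsingleton (ModExt R M X i) := by
  rw [subsingleton_zero_iff] at h ⊢
  intro x
  have h1 : (x.comp (Ext.mk₀ (ModuleCat.ofHom e.symm.toLinearMap)) (add_zero i)).comp
      (Ext.mk₀ (ModuleCat.ofHom e.toLinearMap)) (add_zero i) = x := by
    rw [Ext.comp_assoc_of_second_deg_zero, Ext.mk₀_comp_mk₀, ← ModuleCat.ofHom_comp,
      LinearEquiv.comp_coe, LinearEquiv.symm_trans_self, LinearEquiv.refl_toLinearMap,
      ModuleCat.ofHom_id, Ext.comp_mk₀_id]
  rw [← h1, h (x.comp (Ext.mk₀ (ModuleCat.ofHom e.symm.toLinearMap)) (add_zero i)), Ext.zero_comp]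

theorem congr_left (e : M ≃ₗ[R] X) {i : ℕ} (h : Subsingleton (ModExt R M N i)) :
    Subsingleton (ModExt R X N i) := by
  rw [subsingleton_zero_iff] at h ⊢
  intro x
  have h1 : (Ext.mk₀ (ModuleCat.ofHom e.symm.toLinearMap)).comp
      ((Ext.mk₀ (ModuleCat.ofHom e.toLinearMap)).comp x (zero_add i)) (zero_add i) = x := by
    rw [Ext.mk₀_comp_mk₀_assoc, ← ModuleCat.ofHom_comp,
      LinearEquiv.comp_coe, LinearEquiv.symm_trans_self, LinearEquiv.refl_toLinearMap,
      ModuleCat.ofHom_id, Ext.mk₀_id_comp]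
  rw [← h1, h ((Ext.mk₀ (ModuleCat.ofHom e.toLinearMap)).comp x (zero_add i)), Ext.comp_zero]

theorem subsingleton_of_subsingleton_right [Subsingleton N] (i : ℕ) :
    Subsingleton (ModExt R M N i) := by
  rw [subsingleton_zero_iff]
  intro x
  rw [← Ext.comp_mk₀_id x, (ModuleCat.isZero_of_subsingleton _).eq_of_src (𝟙 _) 0,
    Ext.mk₀_zero, Ext.comp_zero]

theorem subsingleton_of_subsingleton_left [Subsingleton M] (i : ℕ) :
    Subsingleton (ModExt R M N i) := by
  rw [subsingleton_zero_iff]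
  intro x
  rw [← Ext.mk₀_id_comp x, (ModuleCat.isZero_of_subsingleton (ModuleCat.of R M)).eq_of_src (𝟙 _) 0,
    Ext.mk₀_zero, Ext.zero_comp]

end ModExt

namespace IsSES

theorem ext_mid (h : IsSES f g) {i : ℕ} (h₁ : Subsingleton (ModExt R M X i))
    (h₃ : Subsingleton (ModExt R M Z i)) : Subsingleton (ModExt R M Y i) := by
  rw [ModExt.subsingleton_zero_iff]
  intro x
  obtain ⟨y, rfl⟩ := Ext.covariant_sequence_exact₂ _ h.shortExact x (h₃.elim _ _)
  rw [h₁.elim y 0, Ext.zero_comp]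

theorem ext_right (h : IsSES f g) {i : ℕ} (h₂ : Subsingleton (ModExt R M Y i))
    (h₁ : Subsingleton (ModExt R M X (i + 1))) : Subsingleton (ModExt R M Z i) := by
  rw [ModExt.subsingleton_zero_iff]
  intro x
  obtain ⟨y, rfl⟩ := Ext.covariant_sequence_exact₃ _ h.shortExact x rfl (h₁.elim _ _)
  rw [h₂.elim y 0, Ext.zero_comp]

theorem ext_left (h : IsSES f g) {i : ℕ} (h₃ : Subsingleton (ModExt R M Z i))
    (h₂ : Subsingleton (ModExt R M Y (i + 1))) : Subsingleton (ModExt R M X (i + 1)) := by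
  rw [ModExt.subsingleton_zero_iff]
  intro x
  obtain ⟨y, rfl⟩ := Ext.covariant_sequence_exact₁ _ h.shortExact x (h₂.elim _ _) rfl
  rw [h₃.elim y 0, Ext.zero_comp]

theorem ext_contra_mid (h : IsSES f g) {i : ℕ} (h₁ : Subsingleton (ModExt R X N i))
    (h₃ : Subsingleton (ModExt R Z N i)) : Subsingleton (ModExt R Y N i) := by
  rw [ModExt.subsingleton_zero_iff]
  intro x
  obtain ⟨y, rfl⟩ := Ext.contravariant_sequence_exact₂ h.shortExact _ x (h₁.elim _ _)
  rw [h₃.elim y 0, Ext.comp_zero]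

theorem ext_contra_left (h : IsSES f g) {i : ℕ} (h₂ : Subsingleton (ModExt R Y N i))
    (h₃ : Subsingleton (ModExt R Z N (i + 1))) : Subsingleton (ModExt R X N i) := by
  rw [ModExt.subsingleton_zero_iff]
  intro x
  obtain ⟨y, rfl⟩ := Ext.contravariant_sequence_exact₁ h.shortExact _ x (add_comm 1 i) (h₃.elim _ _)
  rw [h₂.elim y 0, Ext.comp_zero]

theorem ext_contra_right (h : IsSES f g) {i : ℕ} (h₁ : Subsingleton (ModExt R X N i))
    (h₂ : Subsingleton (ModExt R Y N (i + 1))) : Subsingleton (ModExt R Z N (i + 1)) := by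
  rw [ModExt.subsingleton_zero_iff]
  intro x
  obtain ⟨y, rfl⟩ := Ext.contravariant_sequence_exact₃ h.shortExact _ x (h₂.elim _ _) (add_comm 1 i)
  rw [h₁.elim y 0, Ext.comp_zero]

/-- Dimension shifting along a presentation `0 → X → Y → Z → 0` with `Y` projective. -/
theorem ext_shift (h : IsSES f g) [Module.Projective R Y] (i : ℕ) :
    Subsingleton (ModExt R Z N (i + 1 + 1)) ↔ Subsingleton (ModExt R X N (i + 1)) :=
  ⟨fun h₃ => h.ext_contra_left (ModExt.subsingleton_of_projective N _) h₃,
   fun h₁ => h.ext_contra_right h₁ (ModExt.subsingleton_of_projective N _)⟩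

/-- `Ext^1` is the cokernel of restriction to the first syzygy. -/
theorem ext_one_iff (h : IsSES f g) [Module.Projective R Y] :
    Subsingleton (ModExt R Z N 1) ↔ ∀ φ : X →ₗ[R] N, ∃ ψ : Y →ₗ[R] N, ψ ∘ₗ f = φ := by
  constructor
  · intro h₃ φ
    obtain ⟨y, hy⟩ := Ext.contravariant_sequence_exact₁ h.shortExact (ModuleCat.of R N)
      (Ext.mk₀ (ModuleCat.ofHom φ)) (add_comm 1 0) (h₃.elim _ _)
    obtain ⟨ψ, rfl⟩ := (Ext.mk₀_bijective _ _).2 y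
    rw [Ext.mk₀_comp_mk₀] at hy
    have := (Ext.mk₀_bijective _ _).1 hy
    exact ⟨ψ.hom, by simpa using congrArg ModuleCat.Hom.hom this⟩
  · intro H
    rw [ModExt.subsingleton_zero_iff]
    intro x
    obtain ⟨y, rfl⟩ := Ext.contravariant_sequence_exact₃ h.shortExact _ x
      ((ModExt.subsingleton_of_projective (M := Y) N 0).elim _ _) (add_comm 1 0)
    obtain ⟨φ, rfl⟩ := (Ext.mk₀_bijective _ _).2 y
    obtain ⟨ψ, hψ⟩ := H φ.hom
    have h1 : φ = ModuleCat.ofHom f ≫ ModuleCat.ofHom ψ := by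
      rw [← ModuleCat.ofHom_comp, hψ]; rfl
    rw [h1, ← Ext.mk₀_comp_mk₀, ← Ext.comp_assoc (a₁₂ := 1) (h₁₂ := rfl) (h₂₃ := rfl) (h := rfl)]
    erw [h.shortExact.extClass_comp]
    rw [Ext.zero_comp]

end IsSES

theorem Module.length_le_add_of_exact {A B C : Type*} [AddCommGroup A] [Module R A]
    [AddCommGroup B] [Module R B] [AddCommGroup C] [Module R C] (f : A →ₗ[R] B) (g : B →ₗ[R] C)
    (H : ∀ b, g b = 0 → ∃ a, f a = b) :
    Module.length R B ≤ Module.length R A + Module.length R C := by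
  rw [Module.length_eq_add_of_exact (LinearMap.ker g).subtype g.rangeRestrict
    (Submodule.injective_subtype _) g.surjective_rangeRestrict
    (by intro x; simp [LinearMap.rangeRestrict, ← LinearMap.mem_ker])]
  refine add_le_add ?_ (Module.length_le_of_injective (LinearMap.range g).subtype
    (Submodule.injective_subtype _))
  have hle : LinearMap.ker g ≤ LinearMap.range f := fun b hb => H b hb
  exact (Module.length_le_of_injective (Submodule.inclusion hle)
    (Submodule.inclusion_injective hle)).trans
      (Module.length_le_of_surjective f.rangeRestrict f.surjective_rangeRestrict)

/-- The length of the `R`-module `Ext^i_R(M, N)`. -/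
noncomputable abbrev extLength (R : Type u) [CommRing R] (M N : Type u) [AddCommGroup M]
    [Module R M] [AddCommGroup N] [Module R N] (i : ℕ) : ℕ∞ :=
  Module.length R (ModExt R M N i)

theorem extLength_eq_zero_iff {i : ℕ} :
    extLength R M N i = 0 ↔ Subsingleton (ModExt R M N i) :=
  Module.length_eq_zero_iff

namespace IsSES

theorem extLength_mid_le (h : IsSES f g) (i : ℕ) :
    extLength R M Y i ≤ extLength R M X i + extLength R M Z i :=
  Module.length_le_add_of_exact
    ((Ext.mk₀ (ModuleCat.ofHom f)).postcompOfLinear R (ModuleCat.of R M) (add_zero i))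
    ((Ext.mk₀ (ModuleCat.ofHom g)).postcompOfLinear R (ModuleCat.of R M) (add_zero i))
    fun x hx => Ext.covariant_sequence_exact₂ _ h.shortExact x hx

theorem extLength_succ_le (h : IsSES f g) {i : ℕ} (h₂ : Subsingleton (ModExt R M Y (i + 1))) :
    extLength R M X (i + 1) ≤ extLength R M Z i :=
  Module.length_le_of_surjective
    (h.shortExact.extClass.postcompOfLinear R (ModuleCat.of R M) rfl)
    fun x => Ext.covariant_sequence_exact₁ _ h.shortExact x (h₂.elim _ _) rfl

end IsSES

/-- `Ext` is additive in its second argument. -/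
noncomputable def ModExt.piEquiv {ι : Type} [Fintype ι] [DecidableEq ι] (i : ℕ) :
    ModExt R M (ι → N) i ≃ₗ[R] (ι → ModExt R M N i) where
  toFun x k := x.comp (Ext.mk₀ (ModuleCat.ofHom (LinearMap.proj k))) (add_zero i)
  invFun y := ∑ k, (y k).comp (Ext.mk₀ (ModuleCat.ofHom (LinearMap.single R (fun _ => N) k)))
    (add_zero i)
  map_add' x y := by ext k; simp
  map_smul' r x := by ext k; simp
  left_inv x := by
    simp only [Ext.comp_assoc_of_second_deg_zero, Ext.mk₀_comp_mk₀, ← Ext.comp_sum,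
      ← Ext.mk₀_sum]
    have : ∑ k : ι, ModuleCat.ofHom (LinearMap.proj (R := R) (φ := fun _ : ι => N) k) ≫
        ModuleCat.ofHom (LinearMap.single R (fun _ : ι => N) k) = 𝟙 _ := by
      ext v
      simp [ModuleCat.hom_sum]
    rw [this, Ext.comp_mk₀_id]
  right_inv y := by
    ext k
    simp only [Ext.sum_comp, Ext.comp_assoc_of_second_deg_zero, Ext.mk₀_comp_mk₀]
    rw [Finset.sum_eq_single k _ (by simp)]
    · rw [← ModuleCat.ofHom_comp, LinearMap.proj_comp_single_same, ModuleCat.ofHom_id,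
        Ext.comp_mk₀_id]
    · intro j _ hj
      rw [← ModuleCat.ofHom_comp, LinearMap.proj_comp_single_ne _ _ _ _ hj.symm]
      erw [Ext.mk₀_zero]
      rw [Ext.comp_zero]

theorem extLength_pi (s i : ℕ) :
    extLength R M (Fin s → N) i = s * extLength R M N i := by
  rw [extLength, (ModExt.piEquiv i).length_eq]
  simp

theorem ModExt.subsingleton_pi {s i : ℕ} (h : Subsingleton (ModExt R M N i)) :
    Subsingleton (ModExt R M (Fin s → N) i) := by
  rw [← extLength_eq_zero_iff] at h ⊢
  rw [extLength_pi, h, mul_zero]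

end Toolkit

section Noetherian

variable {R : Type u} [CommRing R] {M N : Type u}
  [AddCommGroup M] [Module R M] [AddCommGroup N] [Module R N]

/-- A finitely generated module has a presentation by a finite free module of the same universe. -/
theorem exists_free_presentation (R : Type u) [CommRing R] (M : Type u) [AddCommGroup M]
    [Module R M] [Module.Finite R M] :
    ∃ (m : ℕ) (g : (Fin m → R) →ₗ[R] M), Function.Surjective g :=
  Module.Finite.exists_fin' R M

theorem extLength_ne_top [IsNoetherianRing R] [Module.Finite R M] [Module.Finite R N]
    [IsArtinian R N] (i : ℕ) : extLength R M N i ≠ ⊤ := by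
  suffices IsArtinian R (ModExt R M N i) by
    have := ModuleCat.finite_ext R (ModuleCat.of R M) (ModuleCat.of R N) i
    exact Module.length_ne_top
  induction i generalizing M with
  | zero =>
    obtain ⟨m, g, hg⟩ := exists_free_presentation R M
    have hinj : Function.Injective (LinearMap.lcomp R N g) := fun φ ψ h => by
      ext x
      obtain ⟨y, rfl⟩ := hg x
      exact LinearMap.congr_fun h y
    have : IsArtinian R ((Fin m → R) →ₗ[R] N) :=
      isArtinian_of_linearEquiv ((Pi.basisFun R (Fin m)).constr (M' := N) R)
    have : IsArtinian R (M →ₗ[R] N) := isArtinian_of_injective _ hinj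
    exact isArtinian_of_linearEquiv (Ext.linearEquiv₀.trans ModuleCat.homLinearEquiv).symm
  | succ i ih =>
    obtain ⟨m, g, hg⟩ := exists_free_presentation R M
    have hs := IsSES.ker hg
    have := ih (M := LinearMap.ker g)
    exact isArtinian_of_surjective _
      (hs.shortExact.extClass.precompOfLinear R (ModuleCat.of R N) (add_comm 1 i)) fun x =>
        Ext.contravariant_sequence_exact₃ hs.shortExact _ x
          ((ModExt.subsingleton_of_projective (M := Fin m → R) N i).elim _ _) (add_comm 1 i)

/-- If `a` is `N`-regular, in the maximal ideal, and `Ext^i(M, N / aN) = 0`, then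
`Ext^i(M, N) = 0`; the exact sequence is given abstractly. -/
theorem IsSES.ext_eq_zero_of_smul [IsNoetherianRing R] [IsLocalRing R] [Module.Finite R M]
    {Z : Type u} [AddCommGroup Z] [Module R Z] [Module.Finite R N] {a : R}
    (ha : a ∈ IsLocalRing.maximalIdeal R) {f : N →ₗ[R] N} {g : N →ₗ[R] Z} (h : IsSES f g)
    (hf : ∀ y, f y = a • y) {i : ℕ} (h₃ : Subsingleton (ModExt R M Z i)) :
    Subsingleton (ModExt R M N i) := by
  have hfin : Module.Finite R (ModExt R M N i) :=
    ModuleCat.finite_ext R (ModuleCat.of R M) (ModuleCat.of R N) i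
  have hof : ModuleCat.ofHom f = a • 𝟙 (ModuleCat.of R N) := by
    ext y; simp [hf]
  have htop : (⊤ : Submodule R (ModExt R M N i)) ≤ Ideal.span {a} • ⊤ := by
    intro x _
    obtain ⟨y, rfl⟩ := Ext.covariant_sequence_exact₂ _ h.shortExact x (h₃.elim _ _)
    have : y.comp (Ext.mk₀ (ModuleCat.ofHom f)) (add_zero i) = a • y := by
      rw [hof, ← Ext.smul_eq_comp_mk₀]
    erw [this]
    exact Submodule.smul_mem_smul (Ideal.mem_span_singleton_self a) trivial
  have hbot := Submodule.eq_bot_of_le_smul_of_le_jacobson_bot (Ideal.span {a}) ⊤ hfin.fg_top htop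
    (by rw [IsLocalRing.jacobson_eq_maximalIdeal ⊥ bot_ne_top, Ideal.span_singleton_le_iff_mem]
        exact ha)
  exact (Submodule.subsingleton_iff R).mp ((subsingleton_iff_bot_eq_top).mp hbot.symm)

end Noetherian

/-! ### Self-injective Artinian local rings -/

section Gorenstein

variable {B : Type u} [CommRing B]

/-- The socle of an Artinian local ring contains an element with annihilator the maximal ideal. -/
theorem exists_socle_element (B : Type u) [CommRing B] [IsLocalRing B] [IsArtinianRing B] :
    ∃ s : B, s ≠ 0 ∧ ∀ b, b * s = 0 ↔ b ∈ IsLocalRing.maximalIdeal B := by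
  obtain ⟨p, hp⟩ := associatedPrimes.nonempty B B
  obtain ⟨hprime, s, hs⟩ := isAssociatedPrime_iff.mp hp
  have hmax : p = IsLocalRing.maximalIdeal B := IsLocalRing.eq_maximalIdeal inferInstance
  have hmem : ∀ b, b * s = 0 ↔ b ∈ IsLocalRing.maximalIdeal B := fun b => by
    rw [← hmax, hs, Submodule.mem_colon_singleton, Submodule.mem_bot, smul_eq_mul]
  refine ⟨s, fun h0 => ?_, hmem⟩
  have := (hmem 1).mp (by rw [h0, mul_zero])
  exact (Ideal.ne_top_iff_one _).mp (IsLocalRing.maximalIdeal.isMaximal B).ne_top this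

/-- Over an Artinian local ring, vanishing of `Ext^{i+2}(-, B)` on finitely generated modules
descends to `Ext^{i+1}(-, B)`: the residue field embeds into the free module `B`, so it is a
first syzygy. -/
theorem ext_self_descend [IsLocalRing B] [IsArtinianRing B] (i : ℕ)
    (H : ∀ (X : Type u) [AddCommGroup X] [Module B X] [Module.Finite B X],
      Subsingleton (ModExt B X B (i + 1 + 1)))
    (X : Type u) [AddCommGroup X] [Module B X] [Module.Finite B X] :
    Subsingleton (ModExt B X B (i + 1)) := by
  obtain ⟨s, -, hs⟩ := exists_socle_element B
  have hk : Subsingleton (ModExt B (B ⧸ IsLocalRing.maximalIdeal B) B (i + 1)) := by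
    let f : (B ⧸ IsLocalRing.maximalIdeal B) →ₗ[B] B :=
      Submodule.liftQ _ (LinearMap.toSpanSingleton B B s) fun b hb => by
        simpa using (hs b).mpr hb
    have hf : Function.Injective f := by
      rw [← LinearMap.ker_eq_bot, Submodule.ker_liftQ_eq_bot]
      intro b hb
      exact (hs b).mp (by simpa using hb)
    have hses : IsSES f (LinearMap.range f).mkQ :=
      ⟨hf, Submodule.mkQ_surjective _, LinearMap.exact_map_mkQ_range f⟩
    exact hses.ext_contra_left (ModExt.subsingleton_of_projective B i) (H _)
  induction ‹Module.Finite B X› using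
    IsNoetherianRing.induction_on_isQuotientEquivQuotientPrime B with
  | subsingleton N => exact ModExt.subsingleton_of_subsingleton_left _
  | quotient N p e =>
    have hmax : p.1 = IsLocalRing.maximalIdeal B :=
      have := p.2
      IsLocalRing.eq_maximalIdeal inferInstance
    exact ModExt.congr_left (e.trans (Submodule.quotEquivOfEq _ _ hmax)).symm hk
  | exact N₁ N₂ N₃ f g hf hg hfg h₁ h₃ => exact IsSES.ext_contra_mid ⟨hf, hg, hfg⟩ h₁ h₃

/-- An Artinian local ring of finite injective dimension is self-injective. -/
theorem injective_self_of_artinian [IsLocalRing B] [IsArtinianRing B]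
    (h : ∃ d : ℕ, HasInjectiveDimensionLE (ModuleCat.of B B) d) : Module.Injective B B := by
  obtain ⟨d, hd⟩ := h
  have key : ∀ e : ℕ, ∀ (X : Type u) [AddCommGroup X] [Module B X] [Module.Finite B X],
      Subsingleton (ModExt B X B (d - e + 1)) := by
    intro e
    induction e with
    | zero =>
      intro X _ _ _
      exact HasInjectiveDimensionLT.subsingleton _ (d + 1) _ le_rfl _
    | succ e ih =>
      rcases Nat.lt_or_ge e d with h | h
      · intro X _ _ _
        refine ext_self_descend _ ?_ X
        have h1 : d - (e + 1) + 1 + 1 = d - e + 1 := by omega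
        rw [h1]
        exact ih
      · have h1 : d - (e + 1) + 1 = d - e + 1 := by omega
        rw [h1]
        exact ih
  have h1 : ∀ (X : Type u) [AddCommGroup X] [Module B X] [Module.Finite B X],
      Subsingleton (ModExt B X B 1) := by
    have := key d
    rwa [Nat.sub_self] at this
  refine Module.Baer.injective fun I φ => ?_
  obtain ⟨ψ, hψ⟩ := (IsSES.mkQ I).ext_one_iff.mp (h1 (B ⧸ I)) φ
  exact ⟨ψ, fun x hx => LinearMap.congr_fun hψ ⟨x, hx⟩⟩

/-- A self-injective Artinian local ring is a cogenerator of its module category. -/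
theorem exists_functional_ne_zero [IsLocalRing B] [IsArtinianRing B] [Module.Injective B B]
    {X : Type u} [AddCommGroup X] [Module B X] {x : X} (hx : x ≠ 0) :
    ∃ φ : X →ₗ[B] B, φ x ≠ 0 := by
  obtain ⟨s, hs0, hs⟩ := exists_socle_element B
  let T := LinearMap.toSpanSingleton B X x
  have hle : LinearMap.ker T ≤ LinearMap.ker (LinearMap.toSpanSingleton B B s) := by
    intro b hb
    have hb' : b • x = 0 := by simpa [T] using hb
    have : b ∈ IsLocalRing.maximalIdeal B := by
      rw [IsLocalRing.mem_maximalIdeal, mem_nonunits_iff]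
      intro hu
      exact hx (hu.smul_eq_zero.mp hb')
    simpa using (hs b).mpr this
  obtain ⟨φ, hφ⟩ := Module.Injective.out (Submodule.liftQ _ T le_rfl)
    (by rw [← LinearMap.ker_eq_bot, Submodule.ker_liftQ_eq_bot]; exact le_rfl)
    (Submodule.liftQ _ (LinearMap.toSpanSingleton B B s) hle)
  have h1 : φ (T 1) = LinearMap.toSpanSingleton B B s 1 := hφ (Submodule.Quotient.mk 1)
  rw [LinearMap.toSpanSingleton_apply, one_smul, LinearMap.toSpanSingleton_apply, one_smul] at h1
  exact ⟨φ, h1.symm ▸ hs0⟩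

end Gorenstein

/-! ### Depth -/

section Depth

variable {R : Type u} [CommRing R]

theorem Module.annihilator_le_of_ses {X Y Z : Type u} [AddCommGroup X] [Module R X]
    [AddCommGroup Y] [Module R Y] [AddCommGroup Z] [Module R Z] {f : X →ₗ[R] Y} {g : Y →ₗ[R] Z}
    (hf : Function.Injective f) (hg : Function.Surjective g) :
    Module.annihilator R Y ≤ Module.annihilator R X ∧
      Module.annihilator R Y ≤ Module.annihilator R Z :=
  ⟨f.annihilator_le_of_injective hf, g.annihilator_le_of_surjective hg⟩

/-- If `N` has depth at least `t` (measured by `Ext^i(k, N)`), and `X` has Krull dimension at most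
the length of `ys`, in the sense that `X / (ys) X` has finite length, then `Ext^i(X, N)`
vanishes for `i + length ys < t`. -/
theorem ext_eq_zero_of_depth [IsNoetherianRing R] [IsLocalRing R] {N : Type u} [AddCommGroup N]
    [Module R N] [Module.Finite R N] {t : ℕ}
    (ht : ∀ i < t, Subsingleton (ModExt R (R ⧸ IsLocalRing.maximalIdeal R) N i))
    (ys : List R) (hys : ∀ y ∈ ys, y ∈ IsLocalRing.maximalIdeal R)
    (X : Type u) [AddCommGroup X] [Module R X] [Module.Finite R X]
    (hX : IsLocalRing.maximalIdeal R ≤ (Module.annihilator R X ⊔ Ideal.ofList ys).radical)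
    (i : ℕ) (hi : i + ys.length < t) : Subsingleton (ModExt R X N i) := by
  induction ys generalizing X i with
  | nil =>
    rw [Ideal.ofList_nil, sup_bot_eq] at hX
    induction ‹Module.Finite R X› using
      IsNoetherianRing.induction_on_isQuotientEquivQuotientPrime R with
    | subsingleton N => exact ModExt.subsingleton_of_subsingleton_left _
    | quotient X p e =>
      rw [e.annihilator_eq, Ideal.annihilator_quotient, p.2.radical] at hX
      have hmax : p.1 = IsLocalRing.maximalIdeal R :=
        le_antisymm (IsLocalRing.le_maximalIdeal p.2.ne_top) hX
      exact ModExt.congr_left (e.trans (Submodule.quotEquivOfEq _ _ hmax)).symm (ht i hi)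
    | exact N₁ N₂ N₃ f g hf hg hfg h₁ h₃ =>
      have hle := Module.annihilator_le_of_ses hf hg
      exact IsSES.ext_contra_mid ⟨hf, hg, hfg⟩ (h₁ (hX.trans (Ideal.radical_mono hle.1)))
        (h₃ (hX.trans (Ideal.radical_mono hle.2)))
  | cons y ys ih =>
    have hys' : ∀ z ∈ ys, z ∈ IsLocalRing.maximalIdeal R :=
      fun z hz => hys z (List.mem_cons_of_mem _ hz)
    have hym : y ∈ IsLocalRing.maximalIdeal R := hys y List.mem_cons_self
    rw [List.length_cons] at hi
    induction ‹Module.Finite R X› using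
      IsNoetherianRing.induction_on_isQuotientEquivQuotientPrime R with
    | subsingleton N => exact ModExt.subsingleton_of_subsingleton_left _
    | quotient X p e =>
      rw [e.annihilator_eq, Ideal.annihilator_quotient, Ideal.ofList_cons, ← sup_assoc] at hX
      refine ModExt.congr_left e.symm ?_
      by_cases hyp : y ∈ p.1
      · rw [sup_eq_left.mpr ((Ideal.span_singleton_le_iff_mem _).mpr hyp)] at hX
        exact ih hys' _ (by rwa [Ideal.annihilator_quotient]) i (by omega)
      · have := p.2
        let f : (R ⧸ p.1) →ₗ[R] (R ⧸ p.1) := LinearMap.lsmul R _ y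
        have hf : ∀ z, f z = y • z := fun _ => rfl
        have hinj : Function.Injective f := by
          rw [← LinearMap.ker_eq_bot, LinearMap.ker_eq_bot']
          intro z hz
          obtain ⟨z, rfl⟩ := Ideal.Quotient.mk_surjective z
          have h1 : Ideal.Quotient.mk p.1 (y * z) = 0 := hz
          rw [Ideal.Quotient.eq_zero_iff_mem] at h1 ⊢
          exact (p.2.mem_or_mem h1).resolve_left hyp
        have hses : IsSES f (LinearMap.range f).mkQ :=
          ⟨hinj, Submodule.mkQ_surjective _, LinearMap.exact_map_mkQ_range f⟩
        have hann : p.1 ⊔ Ideal.span {y} ≤ Module.annihilator R ((R ⧸ p.1) ⧸ LinearMap.range f) := by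
          rw [sup_le_iff, Ideal.span_singleton_le_iff_mem]
          refine ⟨?_, ?_⟩
          · have := (LinearMap.range f).mkQ.annihilator_le_of_surjective (Submodule.mkQ_surjective _)
            rwa [Ideal.annihilator_quotient] at this
          · rw [Module.mem_annihilator]
            intro z
            obtain ⟨z, rfl⟩ := Submodule.mkQ_surjective _ z
            rw [← map_smul, Submodule.mkQ_apply, Submodule.Quotient.mk_eq_zero]
            exact ⟨z, rfl⟩
        have h₃ := ih hys' ((R ⧸ p.1) ⧸ LinearMap.range f)
          (hX.trans (Ideal.radical_mono (sup_le_sup_right hann _))) (i + 1) (by omega)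
        have hfin : Module.Finite R (ModExt R (R ⧸ p.1) N i) :=
          ModuleCat.finite_ext R (ModuleCat.of R (R ⧸ p.1)) (ModuleCat.of R N) i
        have hof : ModuleCat.ofHom f = y • 𝟙 (ModuleCat.of R (R ⧸ p.1)) := by
          ext; simp [hf]
        have htop : (⊤ : Submodule R (ModExt R (R ⧸ p.1) N i)) ≤ Ideal.span {y} • ⊤ := by
          intro x _
          obtain ⟨w, rfl⟩ := Ext.contravariant_sequence_exact₁ hses.shortExact _ x
            (add_comm 1 i) (h₃.elim _ _)
          have : (Ext.mk₀ (ModuleCat.ofHom f)).comp w (zero_add i) = y • w := by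
            rw [hof, Ext.mk₀_smul, Ext.smul_comp, Ext.mk₀_id_comp]
          erw [this]
          exact Submodule.smul_mem_smul (Ideal.mem_span_singleton_self y) trivial
        have hbot := Submodule.eq_bot_of_le_smul_of_le_jacobson_bot (Ideal.span {y}) ⊤
          hfin.fg_top htop
          (by rw [IsLocalRing.jacobson_eq_maximalIdeal ⊥ bot_ne_top,
                Ideal.span_singleton_le_iff_mem]
              exact hym)
        exact (Submodule.subsingleton_iff R).mp ((subsingleton_iff_bot_eq_top).mp hbot.symm)
    | exact N₁ N₂ N₃ f g hf hg hfg h₁ h₃ =>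
      have hle := Module.annihilator_le_of_ses hf hg
      exact IsSES.ext_contra_mid ⟨hf, hg, hfg⟩
        (h₁ (hX.trans (Ideal.radical_mono (sup_le_sup_right hle.1 _))))
        (h₃ (hX.trans (Ideal.radical_mono (sup_le_sup_right hle.2 _))))

open RingTheory.Sequence in
/-- A weakly regular sequence in the maximal ideal bounds from below the degrees in which
`Ext^i(k, N)` is nonzero. -/
theorem ext_residue_eq_zero_of_isWeaklyRegular [IsLocalRing R] (rs : List R)
    (hrs : ∀ r ∈ rs, r ∈ IsLocalRing.maximalIdeal R) (N : Type u) [AddCommGroup N]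
    [Module R N] (h : IsWeaklyRegular N rs) (i : ℕ) (hi : i < rs.length) :
    Subsingleton (ModExt R (R ⧸ IsLocalRing.maximalIdeal R) N i) := by
  induction rs generalizing N i with
  | nil => simp at hi
  | cons r rs ih =>
    rw [isWeaklyRegular_cons_iff] at h
    have hses := h.1.smulShortComplex_shortExact (M := ModuleCat.of R N)
    rw [ModExt.subsingleton_zero_iff]
    intro x
    have h0 : x.comp (Ext.mk₀ ((ModuleCat.of R N).smulShortComplex r).f) (add_zero i) = 0 := by
      rw [ModuleCat.smulShortComplex_f_eq_smul_id]
      erw [← Ext.smul_eq_comp_mk₀]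
      have h1 : r • 𝟙 (ModuleCat.of R (R ⧸ IsLocalRing.maximalIdeal R)) = 0 := by
        ext
        rename_i z
        change Ideal.Quotient.mk _ (r * 1) = 0
        rw [mul_one]
        exact Ideal.Quotient.eq_zero_iff_mem.mpr (hrs r List.mem_cons_self)
      rw [← Ext.mk₀_id_comp x, ← Ext.smul_comp, ← Ext.mk₀_smul, h1, Ext.mk₀_zero, Ext.zero_comp]
      rfl
    cases i with
    | zero =>
      have := hses.mono_f
      exact Ext.postcomp_mk₀_injective_of_mono _ ((ModuleCat.of R N).smulShortComplex r).f
        (h0.trans (Ext.zero_comp _ _ _ _ (add_zero 0)).symm)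
    | succ i =>
      obtain ⟨w, rfl⟩ := Ext.covariant_sequence_exact₁ _ hses x h0 rfl
      have hsub := ih (fun z hz => hrs z (List.mem_cons_of_mem _ hz)) (QuotSMulTop r N) h.2 i
        (by simpa using hi)
      have : w = 0 := hsub.elim _ _
      rw [this, Ext.zero_comp]
      rfl

end Depth

/-! ### Regular sequences and parameter ideals -/

section Sequences

variable {R : Type u} [CommRing R]

theorem mem_smul_top_pi {m : ℕ} (K : Ideal R) (b : Fin m → R) :
    b ∈ K • (⊤ : Submodule R (Fin m → R)) ↔ ∀ i, b i ∈ K := by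
  constructor
  · intro hb i
    have := Submodule.mem_map_of_mem (f := LinearMap.proj (R := R) (φ := fun _ : Fin m => R) i) hb
    rw [Submodule.map_smul''] at this
    simpa using Submodule.smul_mono le_rfl le_top this
  · intro hb
    rw [pi_eq_sum_univ' b]
    exact Submodule.sum_mem _ fun i _ => Submodule.smul_mem_smul (hb i) trivial

theorem map_mem_smul_top {X Y : Type u} [AddCommGroup X] [Module R X] [AddCommGroup Y] [Module R Y]
    (f : X →ₗ[R] Y) {K : Ideal R} {z : X} (hz : z ∈ K • (⊤ : Submodule R X)) :
    f z ∈ K • (⊤ : Submodule R Y) := by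
  have := Submodule.mem_map_of_mem (f := f) hz
  rw [Submodule.map_smul''] at this
  exact Submodule.smul_mono le_rfl le_top this

/-- The ideal generated by the first `k` terms `x 0, …, x (k - 1)` of a sequence. -/
def seqIdeal (x : ℕ → R) (k : ℕ) : Ideal R := Ideal.span (x '' Set.Iio k)

theorem seqIdeal_zero (x : ℕ → R) : seqIdeal x 0 = ⊥ := by
  simp [seqIdeal]

theorem seqIdeal_succ (x : ℕ → R) (k : ℕ) :
    seqIdeal x (k + 1) = seqIdeal x k ⊔ Ideal.span {x k} := by
  rw [seqIdeal, seqIdeal, ← Ideal.span_union, ← Set.image_singleton, ← Set.image_union]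
  congr 2
  ext j
  simp

theorem mem_seqIdeal (x : ℕ → R) {j k : ℕ} (h : j < k) : x j ∈ seqIdeal x k :=
  Ideal.subset_span ⟨j, h, rfl⟩

theorem seqIdeal_mono (x : ℕ → R) {j k : ℕ} (h : j ≤ k) : seqIdeal x j ≤ seqIdeal x k :=
  Ideal.span_mono (Set.image_mono (Set.Iio_subset_Iio h))

variable {N : Type u} [AddCommGroup N] [Module R N]

theorem mem_seqIdeal_succ_smul_top {x : ℕ → R} {k : ℕ} {a : N} :
    a ∈ seqIdeal x (k + 1) • (⊤ : Submodule R N) ↔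
      ∃ q ∈ seqIdeal x k • (⊤ : Submodule R N), ∃ b : N, a = q + x k • b := by
  rw [seqIdeal_succ, Submodule.sup_smul, Submodule.mem_sup]
  refine exists_congr fun q => and_congr_right fun _ => ⟨?_, ?_⟩
  · rintro ⟨z, hz, rfl⟩
    rw [Submodule.ideal_span_singleton_smul] at hz
    obtain ⟨b, -, rfl⟩ := Submodule.mem_smul_pointwise_iff_exists _ _ _ |>.mp hz
    exact ⟨b, rfl⟩
  · rintro ⟨b, rfl⟩
    exact ⟨x k • b, Submodule.smul_mem_smul (Ideal.mem_span_singleton_self _) trivial, rfl⟩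

/-- `x 0, …, x (n - 1)` is a weakly regular sequence on `N`: each `x k` with `k < n` is a
nonzerodivisor on `N / (x 0, …, x (k - 1)) N`. -/
def IsRegularOn (x : ℕ → R) (n : ℕ) (N : Type u) [AddCommGroup N] [Module R N] : Prop :=
  ∀ k < n, ∀ a : N, x k • a ∈ seqIdeal x k • (⊤ : Submodule R N) →
    a ∈ seqIdeal x k • (⊤ : Submodule R N)

/-- The quotient of a module by the first `k` terms of a sequence. -/
abbrev SeqQuot (x : ℕ → R) (k : ℕ) (N : Type u) [AddCommGroup N] [Module R N] : Type u :=
  N ⧸ (seqIdeal x k • (⊤ : Submodule R N))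

theorem isSES_seqQuot {x : ℕ → R} {k : ℕ}
    (h : ∀ a : N, x k • a ∈ seqIdeal x k • (⊤ : Submodule R N) →
      a ∈ seqIdeal x k • (⊤ : Submodule R N)) :
    IsSES (LinearMap.lsmul R (SeqQuot x k N) (x k))
      (Submodule.factor (Submodule.smul_mono_left (seqIdeal_mono x k.le_succ)) :
        SeqQuot x k N →ₗ[R] SeqQuot x (k + 1) N) where
  inj := by
    rw [← LinearMap.ker_eq_bot, LinearMap.ker_eq_bot']
    intro z hz
    obtain ⟨z, rfl⟩ := Submodule.mkQ_surjective _ z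
    rw [LinearMap.lsmul_apply, ← map_smul, Submodule.mkQ_apply,
      Submodule.Quotient.mk_eq_zero] at hz
    rw [Submodule.mkQ_apply, Submodule.Quotient.mk_eq_zero]
    exact h z hz
  surj := Submodule.factor_surjective _
  exact := by
    intro z
    obtain ⟨z, rfl⟩ := Submodule.mkQ_surjective _ z
    rw [Submodule.factor_mk, Submodule.mkQ_apply, Submodule.Quotient.mk_eq_zero,
      mem_seqIdeal_succ_smul_top]
    constructor
    · rintro ⟨q, hq, b, rfl⟩
      refine ⟨Submodule.Quotient.mk b, ?_⟩
      rw [LinearMap.lsmul_apply, ← Submodule.Quotient.mk_smul, eq_comm, Submodule.mkQ_apply,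
        Submodule.Quotient.eq]
      simpa using hq
    · rintro ⟨b, hb⟩
      obtain ⟨b, rfl⟩ := Submodule.mkQ_surjective _ b
      rw [LinearMap.lsmul_apply, ← map_smul, eq_comm, Submodule.mkQ_apply, Submodule.mkQ_apply,
        Submodule.Quotient.eq] at hb
      exact ⟨_, hb, b, by abel⟩

/-- Dividing by nothing changes nothing. -/
noncomputable def seqQuotZeroEquiv (x : ℕ → R) (N : Type u) [AddCommGroup N] [Module R N] :
    SeqQuot x 0 N ≃ₗ[R] N :=
  Submodule.quotEquivOfEqBot _ (by rw [seqIdeal_zero, Submodule.bot_smul])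

theorem IsRegularOn.ext_seqQuot {x : ℕ → R} {n : ℕ} (h : IsRegularOn x n N) {M : Type u}
    [AddCommGroup M] [Module R M] {a : ℕ} (hM : ∀ i, a < i → Subsingleton (ModExt R M N i))
    {k : ℕ} (hk : k ≤ n) (i : ℕ) (hi : a < i) : Subsingleton (ModExt R M (SeqQuot x k N) i) := by
  induction k generalizing i with
  | zero => exact ModExt.congr_right (seqQuotZeroEquiv x N).symm (hM i hi)
  | succ k ih =>
    exact (isSES_seqQuot (h k hk)).ext_right (ih (by omega) i hi) (ih (by omega) (i + 1) (by omega))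

/-- Nakayama: `Ext^i(M, N)` vanishes if `Ext^i(M, N / (x) N)` does. -/
theorem IsRegularOn.ext_of_seqQuot [IsNoetherianRing R] [IsLocalRing R] [Module.Finite R N]
    {x : ℕ → R} {n : ℕ} (h : IsRegularOn x n N)
    (hx : ∀ k < n, x k ∈ IsLocalRing.maximalIdeal R) {M : Type u}
    [AddCommGroup M] [Module R M] [Module.Finite R M] {i : ℕ}
    (hM : Subsingleton (ModExt R M (SeqQuot x n N) i)) : Subsingleton (ModExt R M N i) := by
  have key : ∀ k ≤ n, Subsingleton (ModExt R M (SeqQuot x (n - k) N) i) := by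
    intro k
    induction k with
    | zero => intro _; exact hM
    | succ k ih =>
      intro hk
      have h1 : n - k = n - (k + 1) + 1 := by omega
      have h2 := ih (by omega)
      rw [h1] at h2
      exact (isSES_seqQuot (h (n - (k + 1)) (by omega))).ext_eq_zero_of_smul
        (hx _ (by omega)) (fun _ => rfl) h2
  have := key n le_rfl
  rw [Nat.sub_self] at this
  exact ModExt.congr_right (seqQuotZeroEquiv x N) this

/-- In a Cohen–Macaulay module, a system of parameters is a regular sequence. Regularity of `x k`
says that there are no nonzero maps `R / (x 0, …, x k) → N / (x 0, …, x (k-1)) N`. -/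
theorem isRegularOn_of_depth [IsNoetherianRing R] [IsLocalRing R] [Module.Finite R N]
    {x : ℕ → R} {n : ℕ} (hx : ∀ k < n, x k ∈ IsLocalRing.maximalIdeal R)
    (hrad : IsLocalRing.maximalIdeal R ≤ (seqIdeal x n).radical)
    (hN : ∀ i < n, Subsingleton (ModExt R (R ⧸ IsLocalRing.maximalIdeal R) N i)) :
    IsRegularOn x n N := by
  have key : ∀ k ≤ n, (∀ j < k, ∀ a : N, x j • a ∈ seqIdeal x j • (⊤ : Submodule R N) →
      a ∈ seqIdeal x j • (⊤ : Submodule R N)) ∧ ∀ i, i < n - k →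
      Subsingleton (ModExt R (R ⧸ IsLocalRing.maximalIdeal R) (SeqQuot x k N) i) := by
    intro k
    induction k with
    | zero =>
      intro _
      exact ⟨fun j hj => absurd hj (Nat.not_lt_zero j),
        fun i hi => ModExt.congr_right (seqQuotZeroEquiv x N).symm (hN i (by omega))⟩
    | succ k ih =>
      intro hk
      obtain ⟨h1, h2⟩ := ih (by omega)
      have hreg : ∀ a : N, x k • a ∈ seqIdeal x k • (⊤ : Submodule R N) →
          a ∈ seqIdeal x k • (⊤ : Submodule R N) := by
        intro a ha
        let ys : List R := (List.range' (k + 1) (n - (k + 1))).map x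
        have hlen : ys.length = n - (k + 1) := by simp [ys]
        have hle : seqIdeal x n ≤ seqIdeal x (k + 1) ⊔ Ideal.ofList ys := by
          rw [seqIdeal, Ideal.span_le]
          rintro _ ⟨j, hj, rfl⟩
          rcases Nat.lt_or_ge j (k + 1) with hjk | hjk
          · exact Ideal.mem_sup_left (mem_seqIdeal x hjk)
          · refine Ideal.mem_sup_right (Ideal.subset_span ?_)
            refine List.mem_map.mpr ⟨j, List.mem_range'_1.mpr ⟨hjk, ?_⟩, rfl⟩
            have : j < n := hj
            omega
        have hvan := ext_eq_zero_of_depth h2 ys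
          (by
            intro y hy
            obtain ⟨j, hj, rfl⟩ := List.mem_map.mp hy
            have := List.mem_range'_1.mp hj
            exact hx j (by omega))
          (R ⧸ seqIdeal x (k + 1))
          (hrad.trans (Ideal.radical_mono (by rwa [Ideal.annihilator_quotient]))) 0
          (by rw [hlen]; omega)
        let φ : (R ⧸ seqIdeal x (k + 1)) →ₗ[R] SeqQuot x k N :=
          Submodule.liftQ _ (LinearMap.toSpanSingleton R _ (Submodule.Quotient.mk a)) (by
            rw [seqIdeal_succ, sup_le_iff, Ideal.span_singleton_le_iff_mem]
            refine ⟨fun q hq => ?_, ?_⟩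
            · rw [LinearMap.mem_ker, LinearMap.toSpanSingleton_apply,
                ← Submodule.Quotient.mk_smul, Submodule.Quotient.mk_eq_zero]
              exact Submodule.smul_mem_smul hq trivial
            · rw [LinearMap.mem_ker, LinearMap.toSpanSingleton_apply,
                ← Submodule.Quotient.mk_smul, Submodule.Quotient.mk_eq_zero]
              exact ha)
        have hφ : ModuleCat.ofHom φ = 0 :=
          (Ext.mk₀_bijective _ _).1 (hvan.elim _ _)
        have h3 : φ (Submodule.Quotient.mk 1) = 0 := by
          have : φ = 0 := congrArg ModuleCat.Hom.hom hφ
          rw [this, LinearMap.zero_apply]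
        have h4 : φ (Submodule.Quotient.mk 1) = Submodule.Quotient.mk a := by
          simp [φ, Submodule.liftQ_apply, -Ideal.Quotient.mk_eq_mk]
        rw [h4, Submodule.Quotient.mk_eq_zero] at h3
        exact h3
      refine ⟨fun j hj => ?_, fun i hi => ?_⟩
      · rcases Nat.lt_succ_iff_lt_or_eq.mp hj with hj | rfl
        · exact h1 j hj
        · exact hreg
      · exact (isSES_seqQuot hreg).ext_right (h2 i (by omega)) (h2 (i + 1) (by omega))
  exact (key n le_rfl).1

/-- Depth of syzygies: a submodule `K` of a module on which `x` is regular gains one step of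
regularity over the quotient. -/
theorem IsRegularOn.syzygy {F M K : Type u} [AddCommGroup F] [Module R F] [AddCommGroup M]
    [Module R M] [AddCommGroup K] [Module R K] {f : K →ₗ[R] F} {g : F →ₗ[R] M} (h : IsSES f g)
    {x : ℕ → R} {n k : ℕ} (hF : IsRegularOn x n F) (hM : IsRegularOn x k M) (hk : k + 1 ≤ n) :
    IsRegularOn x (k + 1) K := by
  have key : ∀ j ≤ k, ∀ z : K, f z ∈ seqIdeal x j • (⊤ : Submodule R F) →
      z ∈ seqIdeal x j • (⊤ : Submodule R K) := by
    intro j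
    induction j with
    | zero =>
      intro _ z hz
      rw [seqIdeal_zero, Submodule.bot_smul, Submodule.mem_bot] at hz
      rw [h.inj (hz.trans f.map_zero.symm)]
      exact zero_mem _
    | succ j ih =>
      intro hj z hz
      obtain ⟨q, hq, b, hb⟩ := mem_seqIdeal_succ_smul_top.mp hz
      have h1 : x j • g b ∈ seqIdeal x j • (⊤ : Submodule R M) := by
        have : x j • g b = - g q := by
          rw [← map_smul, ← map_neg, ← sub_eq_zero, ← map_sub, sub_neg_eq_add, add_comm, ← hb,
            h.apply_apply]
        rw [this]
        exact neg_mem (map_mem_smul_top g hq)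
      have h2 := hM j (by omega) _ h1
      have h3 : seqIdeal x j • (⊤ : Submodule R M) =
          (seqIdeal x j • (⊤ : Submodule R F)).map g := by
        rw [Submodule.map_smul'', Submodule.map_top, LinearMap.range_eq_top.mpr h.surj]
      rw [h3] at h2
      obtain ⟨b', hb', hbb⟩ := h2
      obtain ⟨ν, hν⟩ := (h.exact (b - b')).mp (by rw [map_sub, hbb, sub_self])
      refine mem_seqIdeal_succ_smul_top.mpr ⟨z - x j • ν, ih (by omega) _ ?_, ν, by abel⟩
      have : f (z - x j • ν) = q + x j • b' := by
        rw [map_sub, map_smul, hν, hb, smul_sub]; abel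
      rw [this]
      exact add_mem hq (Submodule.smul_mem _ _ hb')
  intro j hj z hz
  refine key j (by omega) z (hF j (by omega) (f z) ?_)
  rw [← map_smul]
  exact map_mem_smul_top f hz

theorem IsRegularOn.mul_mem {x : ℕ → R} {n : ℕ} (h : IsRegularOn x n R) {k : ℕ} (hk : k < n)
    {a : R} (ha : x k * a ∈ seqIdeal x k) : a ∈ seqIdeal x k := by
  have := h k hk a
  simp only [smul_eq_mul, Ideal.mul_top] at this
  exact this ha

theorem IsRegularOn.pi {x : ℕ → R} {n : ℕ} (hx : IsRegularOn x n R) (m : ℕ) :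
    IsRegularOn x n (Fin m → R) := by
  intro k hk a ha
  rw [mem_smul_top_pi] at ha ⊢
  exact fun i => hx.mul_mem hk (ha i)

end Sequences

/-! ### Free layers of ideals -/

section RelativeBases

variable {R : Type u} [CommRing R]

/-- `u` is a basis of `K / K'` over `R / I`, where `K' ≤ K` are ideals with `I K ≤ K'`, expressed
by lifts of the basis elements to `R`. -/
structure IsRelBasis (I K K' : Ideal R) {ι : Type} [Fintype ι] (u : ι → R) : Prop where
  mul_le : I * K ≤ K'
  span_sup : Ideal.span (Set.range u) ⊔ K' = K
  indep : ∀ a : ι → R, ∑ i, a i * u i ∈ K' → ∀ i, a i ∈ I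

theorem IsRelBasis.le {I K K' : Ideal R} {ι : Type} [Fintype ι] {u : ι → R}
    (h : IsRelBasis I K K' u) : K' ≤ K :=
  le_sup_right.trans h.span_sup.le

theorem IsRelBasis.mem {I K K' : Ideal R} {ι : Type} [Fintype ι] {u : ι → R}
    (h : IsRelBasis I K K' u) (i : ι) : u i ∈ K :=
  h.span_sup.le (Ideal.mem_sup_left (Ideal.subset_span ⟨i, rfl⟩))

theorem IsRelBasis.reindex {I K K' : Ideal R} {ι κ : Type} [Fintype ι] [Fintype κ] {u : ι → R}
    (h : IsRelBasis I K K' u) (e : κ ≃ ι) : IsRelBasis I K K' (u ∘ e) where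
  mul_le := h.mul_le
  span_sup := by rw [e.surjective.range_comp, h.span_sup]
  indep a ha k := by
    have := h.indep (a ∘ e.symm) (by
      rw [← e.sum_comp]
      simpa using ha) (e k)
    simpa using this

theorem isRelBasis_one (I : Ideal R) : IsRelBasis I ⊤ I (fun _ : Unit => (1 : R)) where
  mul_le := Ideal.mul_le_left
  span_sup := by simp
  indep a ha i := by simpa using ha

theorem mem_mul_span_range {ι : Type} [Fintype ι] (I : Ideal R) (u : ι → R) (z : R) :
    z ∈ I * Ideal.span (Set.range u) ↔ ∃ c : ι → R, (∀ i, c i ∈ I) ∧ ∑ i, c i * u i = z := by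
  rw [← smul_eq_mul, Ideal.span, Submodule.mem_ideal_smul_span_iff_exists_sum]
  constructor
  · rintro ⟨c, hc, rfl⟩
    exact ⟨c, hc, by rw [Finsupp.sum_fintype _ _ (by simp)]; rfl⟩
  · rintro ⟨c, hc, rfl⟩
    refine ⟨Finsupp.equivFunOnFinite.symm c, hc, ?_⟩
    rw [Finsupp.sum_fintype _ _ (by simp)]; rfl

theorem mem_span_range {ι : Type} [Fintype ι] (u : ι → R) (z : R) :
    z ∈ Ideal.span (Set.range u) ↔ ∃ c : ι → R, ∑ i, c i * u i = z :=
  Ideal.mem_span_range_iff_exists_fun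

/-- Powers of an ideal generated by a regular sequence `x 0, …, x (n - 1)`: the `j`-th power has a
generating family (the monomials of degree `j`) that is independent modulo the ideal. The
recursion `Q_{n+1}^{j+1} = Q_n^{j+1} + x_n Q_{n+1}^j` splits the monomials according to whether
they involve `x n`. -/
theorem exists_quasiregular_family (x : ℕ → R) (n : ℕ) (hx : IsRegularOn x n R) (j : ℕ) :
    ∃ (ι : Type) (_ : Fintype ι) (u : ι → R), Fintype.card ι = Nat.multichoose n j ∧
      Ideal.span (Set.range u) = seqIdeal x n ^ j ∧
      ∀ a : ι → R, ∑ i, a i * u i = 0 → ∀ i, a i ∈ seqIdeal x n := by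
  induction n generalizing j with
  | zero =>
    cases j with
    | zero =>
      refine ⟨Unit, inferInstance, fun _ => 1, by simp, by simp, fun a ha i => ?_⟩
      have : a i = 0 := by simpa using ha
      rw [this]
      exact zero_mem _
    | succ j =>
      exact ⟨Empty, inferInstance, Empty.elim, by simp, by simp [seqIdeal_zero],
        fun _ _ i => i.elim⟩
  | succ n ihn =>
    have hx' : IsRegularOn x n R := fun k hk => hx k (by omega)
    specialize ihn hx'
    have hle : seqIdeal x n ≤ seqIdeal x (n + 1) := seqIdeal_mono x n.le_succ
    -- `x n` is a nonzerodivisor modulo every power of `Q_n`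
    have hreg : ∀ j : ℕ, ∀ a : R, x n * a ∈ seqIdeal x n ^ j → a ∈ seqIdeal x n ^ j := by
      intro j
      induction j with
      | zero => intro a _; simp
      | succ j ihj =>
        intro a ha
        obtain ⟨ι, _, u, -, hspan, hind⟩ := ihn j
        have h1 := ihj a (Ideal.pow_le_pow_right j.le_succ ha)
        rw [← hspan, mem_span_range] at h1
        obtain ⟨c, rfl⟩ := h1
        rw [pow_succ', ← hspan, mem_mul_span_range] at ha ⊢
        obtain ⟨q, hq, hqe⟩ := ha
        refine ⟨c, fun i => hx.mul_mem n.lt_succ_self ?_, rfl⟩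
        have h2 := hind (fun i => x n * c i - q i) (by
          simp only [sub_mul, Finset.sum_sub_distrib, hqe, Finset.mul_sum, mul_assoc, sub_self]) i
        simpa using add_mem h2 (hq i)
    induction j with
    | zero =>
      refine ⟨Unit, inferInstance, fun _ => 1, by simp, by simp, fun a ha i => ?_⟩
      have : a i = 0 := by simpa using ha
      rw [this]
      exact zero_mem _
    | succ j ihj =>
      obtain ⟨ι, _, u, hucard, huspan, huind⟩ := ihn (j + 1)
      obtain ⟨κ, _, v, hvcard, hvspan, hvind⟩ := ihj
      refine ⟨ι ⊕ κ, inferInstance, Sum.elim u (fun k => x n * v k), ?_, ?_, ?_⟩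
      · rw [Fintype.card_sum, hucard, hvcard, Nat.multichoose_succ_succ]
      · have h1 : Ideal.span (Set.range fun k => x n * v k) =
            Ideal.span {x n} * seqIdeal x (n + 1) ^ j := by
          rw [← hvspan, Ideal.span_mul_span', Set.singleton_mul, ← Set.range_comp]
          rfl
        rw [Set.Sum.elim_range, Ideal.span_union, huspan, h1]
        apply le_antisymm
        · refine sup_le (Ideal.pow_right_mono hle _) ?_
          rw [pow_succ']
          refine Ideal.mul_mono_left ?_
          rw [Ideal.span_singleton_le_iff_mem]
          exact mem_seqIdeal x n.lt_succ_self
        · have h2 : ∀ j, seqIdeal x n * seqIdeal x (n + 1) ^ j ≤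
              seqIdeal x n ^ (j + 1) ⊔ Ideal.span {x n} * seqIdeal x (n + 1) ^ j := by
            intro j
            induction j with
            | zero => simp
            | succ j ih =>
              calc seqIdeal x n * seqIdeal x (n + 1) ^ (j + 1)
                  = seqIdeal x n * seqIdeal x (n + 1) ^ j * seqIdeal x (n + 1) := by
                    rw [pow_succ, mul_assoc]
                _ ≤ (seqIdeal x n ^ (j + 1) ⊔ Ideal.span {x n} * seqIdeal x (n + 1) ^ j) *
                    seqIdeal x (n + 1) := Ideal.mul_mono_left ih
                _ = seqIdeal x n ^ (j + 1) * seqIdeal x (n + 1) ⊔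
                    Ideal.span {x n} * seqIdeal x (n + 1) ^ (j + 1) := by
                    rw [Ideal.sup_mul, mul_assoc, ← pow_succ]
                _ ≤ _ := by
                  refine sup_le ?_ le_sup_right
                  conv_lhs => rw [seqIdeal_succ x n, Ideal.mul_sup, ← pow_succ]
                  refine sup_le_sup_left ?_ _
                  rw [mul_comm]
                  exact Ideal.mul_mono_right (Ideal.pow_right_mono hle _)
          conv_lhs => rw [pow_succ', seqIdeal_succ x n, Ideal.sup_mul, ← seqIdeal_succ x n]
          exact sup_le (h2 j) le_sup_right
      · intro a ha
        rw [Fintype.sum_sum_type] at ha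
        simp only [Sum.elim_inl, Sum.elim_inr] at ha
        have hv : ∑ k, a (Sum.inr k) * v k ∈ seqIdeal x n ^ (j + 1) := by
          refine hreg (j + 1) _ ?_
          have : x n * ∑ k, a (Sum.inr k) * v k = - ∑ i, a (Sum.inl i) * u i := by
            rw [eq_neg_iff_add_eq_zero, ← ha, add_comm, Finset.mul_sum]
            congr 1
            exact Finset.sum_congr rfl fun k _ => by ring
          rw [this, ← huspan]
          exact neg_mem ((mem_span_range u _).mpr ⟨_, rfl⟩)
        have hr : ∀ k, a (Sum.inr k) ∈ seqIdeal x (n + 1) := by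
          have h1 := Ideal.pow_right_mono hle _ hv
          rw [pow_succ', ← hvspan, mem_mul_span_range] at h1
          obtain ⟨q, hq, hqe⟩ := h1
          intro k
          have h2 := hvind (fun k => a (Sum.inr k) - q k) (by
            simp only [sub_mul, Finset.sum_sub_distrib, hqe, sub_self]) k
          simpa using add_mem h2 (hq k)
        have hl : ∀ i, a (Sum.inl i) ∈ seqIdeal x (n + 1) := by
          rw [← huspan, mem_span_range] at hv
          obtain ⟨c, hc⟩ := hv
          intro i
          have h2 := huind (fun i => a (Sum.inl i) + x n * c i) (by
            simp only [add_mul, Finset.sum_add_distrib, mul_assoc, ← Finset.mul_sum, hc]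
            rw [← ha, Finset.mul_sum]
            congr 1
            exact Finset.sum_congr rfl fun k _ => by ring) i
          have h3 := sub_mem (hle h2) (Ideal.mul_mem_right (c i) _ (mem_seqIdeal x n.lt_succ_self))
          simpa using h3
        rintro (i | k)
        · exact hl i
        · exact hr k

/-- `Q^j / Q^j I`-independence: a family that generates `Q^j` and has no relations outside `Q`
is independent modulo `I` on `Q^j / I Q^j`, for every ideal `I ≥ Q`. -/
theorem mem_of_sum_mem_mul {ι : Type} [Fintype ι] {u : ι → R} {Q I : Ideal R} (hQI : Q ≤ I)
    (hind : ∀ a : ι → R, ∑ i, a i * u i = 0 → ∀ i, a i ∈ Q) {a : ι → R}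
    (ha : ∑ i, a i * u i ∈ I * Ideal.span (Set.range u)) (i : ι) : a i ∈ I := by
  rw [mem_mul_span_range] at ha
  obtain ⟨q, hq, hqe⟩ := ha
  have h2 := hQI (hind (fun k => a k - q k) (by
    simp only [sub_mul, Finset.sum_sub_distrib, hqe, sub_self]) i)
  simpa using add_mem h2 (hq i)

theorem pow_succ_eq_of_sq_eq {I Q : Ideal R} (h : I ^ 2 = Q * I) (j : ℕ) :
    I ^ (j + 1) = Q ^ j * I := by
  induction j with
  | zero => simp
  | succ j ih => rw [pow_succ, ih, mul_assoc, ← sq, h, ← mul_assoc, ← pow_succ]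

/-- If `I ^ 2 = Q I` with `Q` generated by a regular sequence of length `n` and `I / Q` is free of
rank `r` over `R / I`, then `I^{j+1} / I^{j+2}` is free: writing `I^{j+1} = Q^{j+1} + Q^j I`, a
basis is formed by the monomials of degree `j + 1` and the products of the monomials of degree
`j` with the basis of `I / Q`. -/
theorem exists_relBasis_pow {x : ℕ → R} {n : ℕ} (hx : IsRegularOn x n R) {I : Ideal R}
    (hI : I ^ 2 = seqIdeal x n * I) {r : ℕ} {v : Fin r → R}
    (hv : IsRelBasis I I (seqIdeal x n) v) (j : ℕ) :
    ∃ u : Fin (Nat.multichoose n (j + 1) + r * Nat.multichoose n j) → R,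
      IsRelBasis I (I ^ (j + 1)) (I ^ (j + 1 + 1)) u := by
  obtain ⟨ι, _, u, hucard, huspan, huind⟩ := exists_quasiregular_family x n hx (j + 1)
  obtain ⟨κ, _, w, hwcard, hwspan, hwind⟩ := exists_quasiregular_family x n hx j
  have hcard : Fintype.card (ι ⊕ Fin r × κ) =
      Nat.multichoose n (j + 1) + r * Nat.multichoose n j := by
    rw [Fintype.card_sum, Fintype.card_prod, hucard, hwcard, Fintype.card_fin]
  suffices h : IsRelBasis I (I ^ (j + 1)) (I ^ (j + 1 + 1))
      (Sum.elim u fun p : Fin r × κ => v p.1 * w p.2) from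
    ⟨_, h.reindex ((Fintype.equivFinOfCardEq hcard).symm)⟩
  set Q := seqIdeal x n
  have hQI : Q ≤ I := hv.le
  have hK : I ^ (j + 1) = Q ^ j * I := pow_succ_eq_of_sq_eq hI j
  have hK' : I ^ (j + 1 + 1) = I * Q ^ (j + 1) := by rw [pow_succ_eq_of_sq_eq hI, mul_comm]
  refine ⟨by rw [← pow_succ'], ?_, ?_⟩
  · refine le_antisymm (sup_le ?_ (Ideal.pow_le_pow_right (Nat.le_succ _))) ?_
    · rw [Ideal.span_le]
      rintro _ ⟨i | p, rfl⟩
      · refine Ideal.pow_right_mono hQI _ ?_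
        rw [← huspan]
        exact Ideal.subset_span ⟨i, rfl⟩
      · change v p.1 * w p.2 ∈ I ^ (j + 1)
        rw [hK, mul_comm (v p.1)]
        exact Ideal.mul_mem_mul (hwspan ▸ Ideal.subset_span ⟨p.2, rfl⟩) (hv.mem p.1)
    · refine le_trans ?_ le_sup_left
      rw [hK]
      conv_lhs => rw [← hv.span_sup]
      rw [Ideal.mul_sup, ← pow_succ, ← hwspan, Ideal.span_mul_span', ← huspan]
      refine sup_le (Ideal.span_mono ?_) (Ideal.span_mono ?_)
      · rintro _ ⟨_, ⟨k, rfl⟩, _, ⟨l, rfl⟩, rfl⟩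
        exact ⟨Sum.inr (l, k), mul_comm _ _⟩
      · rintro _ ⟨i, rfl⟩
        exact ⟨Sum.inl i, rfl⟩
  · intro a ha
    rw [Fintype.sum_sum_type, Fintype.sum_prod_type_right] at ha
    simp only [Sum.elim_inl, Sum.elim_inr] at ha
    have hre : ∑ k, ∑ l, a (Sum.inr (l, k)) * (v l * w k) =
        ∑ k, (∑ l, a (Sum.inr (l, k)) * v l) * w k := by
      refine Finset.sum_congr rfl fun k _ => ?_
      rw [Finset.sum_mul]
      exact Finset.sum_congr rfl fun l _ => by ring
    have hu : ∑ i, a (Sum.inl i) * u i ∈ Q ^ (j + 1) := by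
      rw [← huspan]
      exact (mem_span_range u _).mpr ⟨_, rfl⟩
    -- modulo `Q^{j+1}`, the coefficients of the monomials of degree `j` lie in `Q`
    have hr : ∀ p, a (Sum.inr p) ∈ I := by
      have h1 : ∑ k, ∑ l, a (Sum.inr (l, k)) * (v l * w k) ∈ Q ^ (j + 1) := by
        have h2 := sub_mem ((hK'.trans_le Ideal.mul_le_right) ha) hu
        simpa using h2
      rw [hre, pow_succ', ← hwspan] at h1
      rintro ⟨l, k⟩
      exact hv.indep _ (mem_of_sum_mem_mul le_rfl hwind h1 k) l
    have hl : ∀ i, a (Sum.inl i) ∈ I := by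
      refine mem_of_sum_mem_mul hQI huind ?_
      rw [huspan, ← hK']
      have h1 : ∑ k, ∑ l, a (Sum.inr (l, k)) * (v l * w k) ∈ I ^ (j + 1 + 1) := by
        refine sum_mem fun k _ => sum_mem fun l _ => ?_
        rw [pow_succ', hK]
        refine Ideal.mul_mem_mul (hr _) ?_
        rw [mul_comm (v l)]
        exact Ideal.mul_mem_mul (hwspan ▸ Ideal.subset_span ⟨k, rfl⟩) (hv.mem l)
      simpa using sub_mem ha h1
    rintro (i | p)
    · exact hl i
    · exact hr p

theorem multichoose_succ_mul (n m : ℕ) :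
    Nat.multichoose n (m + 1) * (m + 1) = Nat.multichoose (n + 1) m * n := by
  rw [Nat.multichoose_eq, Nat.multichoose_eq]
  have h1 : n + (m + 1) - 1 = n + m := by omega
  have h2 : n + 1 + m - 1 = n + m := by omega
  rw [h1, h2, Nat.choose_succ_right_eq, Nat.add_sub_cancel]

theorem sum_multichoose (n m : ℕ) :
    ∑ j ∈ Finset.range (m + 1), Nat.multichoose n j = Nat.multichoose (n + 1) m := by
  induction m with
  | zero => simp
  | succ m ih => rw [Finset.sum_range_succ, ih, Nat.multichoose_succ_succ, add_comm]

/-- The rank of `I^{j+1} / I^{j+2}` exceeds the total rank of the lower layers as long as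
`j + 2 ≤ n`. -/
theorem rank_lt (n r j : ℕ) (h : j + 2 ≤ n) :
    1 + ∑ k ∈ Finset.range j, (Nat.multichoose n (k + 1) + r * Nat.multichoose n k) <
      Nat.multichoose n (j + 1) + r * Nat.multichoose n j := by
  have h1 : 1 + ∑ k ∈ Finset.range j, Nat.multichoose n (k + 1) <
      Nat.multichoose n (j + 1) := by
    have := sum_multichoose n j
    rw [Finset.sum_range_succ', Nat.multichoose_zero_right, add_comm] at this
    rw [this]
    have h2 := multichoose_succ_mul n j
    have h3 : 0 < Nat.multichoose (n + 1) j := by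
      rw [Nat.multichoose_eq]
      exact Nat.choose_pos (by omega)
    by_contra hcon
    push Not at hcon
    nlinarith
  have h2 : ∑ k ∈ Finset.range j, Nat.multichoose n k ≤ Nat.multichoose n j := by
    cases j with
    | zero => simp
    | succ j =>
      rw [sum_multichoose]
      have h2 := multichoose_succ_mul n j
      by_contra hcon
      push Not at hcon
      nlinarith
  rw [Finset.sum_add_distrib, ← Finset.mul_sum, ← add_assoc]
  exact add_lt_add_of_lt_of_le h1 (Nat.mul_le_mul_left r h2)

/-- If `R / I` is self-injective and Artinian, `I ^ 2 = Q I` with `Q` generated by a regular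
sequence of length `n`, and `I / I ^ 2` is free, then `I / Q` is free: the free submodule
`Q / I ^ 2` of `I / I ^ 2` is injective, hence a direct summand. -/
theorem exists_relBasis_parameter [IsNoetherianRing R] {x : ℕ → R} {n : ℕ}
    (hx : IsRegularOn x n R)
    {I : Ideal R} (hQI : seqIdeal x n ≤ I) (hI : I ^ 2 = seqIdeal x n * I)
    [IsLocalRing (R ⧸ I)] [Module.Injective (R ⧸ I) (R ⧸ I)] [Module.Free (R ⧸ I) I.Cotangent] :
    ∃ (r : ℕ) (v : Fin r → R), IsRelBasis I I (seqIdeal x n) v ∧ I.spanFinrank ≤ n + r := by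
  obtain ⟨ι, _, u, hucard, huspan, huind⟩ := exists_quasiregular_family x n hx 1
  rw [pow_one] at huspan
  rw [Nat.multichoose_one_right] at hucard
  classical
  have huI : ∀ i, u i ∈ I := fun i => hQI (huspan ▸ Ideal.subset_span ⟨i, rfl⟩)
  let B := R ⧸ I
  let f : (ι → B) →ₗ[B] I.Cotangent :=
    Fintype.linearCombination B fun i => I.toCotangent ⟨u i, huI i⟩
  -- `f` on representatives
  have hfmk : ∀ a : ι → R, ∀ h : ∑ i, a i * u i ∈ I,
      f (fun i => Ideal.Quotient.mk I (a i)) = I.toCotangent ⟨∑ i, a i * u i, h⟩ := by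
    intro a h
    have h1 : (⟨∑ i, a i * u i, h⟩ : I) = ∑ i, a i • (⟨u i, huI i⟩ : I) := by
      ext; simp
    rw [h1, map_sum, Fintype.linearCombination_apply]
    refine Finset.sum_congr rfl fun i _ => ?_
    rw [map_smul]
    exact algebraMap_smul B (a i) _
  have hsumI : ∀ a : ι → R, ∑ i, a i * u i ∈ I := fun a =>
    sum_mem fun i _ => Ideal.mul_mem_left _ _ (huI i)
  have hfinj : Function.Injective f := by
    rw [← LinearMap.ker_eq_bot, LinearMap.ker_eq_bot']
    intro b hb
    choose a ha using fun i => Ideal.Quotient.mk_surjective (b i)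
    obtain rfl : (fun i => Ideal.Quotient.mk I (a i)) = b := funext ha
    rw [hfmk a (hsumI a), Ideal.toCotangent_eq_zero, hI, mul_comm, ← huspan] at hb
    ext i
    exact Ideal.Quotient.eq_zero_iff_mem.mpr (mem_of_sum_mem_mul hQI huind hb i)
  obtain ⟨g, hg⟩ := Module.Injective.extension_property B _ _ _ f hfinj LinearMap.id
  have hgf : ∀ b, g (f b) = b := fun b => LinearMap.congr_fun hg b
  let P := LinearMap.ker g
  let p : I.Cotangent →ₗ[B] P :=
    LinearMap.codRestrict P (LinearMap.id - f ∘ₗ g) fun z => by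
      simp [P, LinearMap.mem_ker, hgf]
  have hpid : p ∘ₗ P.subtype = LinearMap.id := by
    ext z
    have hz : g z = 0 := z.2
    simp [p, hz]
  have : IsNoetherianRing B := inferInstance
  have hfin : Module.Finite R I.Cotangent :=
    Module.Finite.of_surjective I.toCotangent I.toCotangent_surjective
  have : Module.Finite B I.Cotangent := Module.Finite.of_restrictScalars_finite R B _
  have : Module.Finite B P := Module.Finite.of_surjective p fun z =>
    ⟨z, LinearMap.congr_fun hpid z⟩
  have : Module.Projective B P := Module.Projective.of_split P.subtype p hpid
  have : Module.Free B P := Module.free_of_flat_of_isLocalRing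
  let bas := Module.finBasis B P
  set r := Module.finrank B P
  choose v hv using fun l : Fin r => I.toCotangent_surjective (bas l : I.Cotangent)
  have hvmk : ∀ a : Fin r → R, ∀ h : ∑ l, a l * (v l : R) ∈ I,
      I.toCotangent ⟨∑ l, a l * (v l : R), h⟩ =
        ((∑ l, Ideal.Quotient.mk I (a l) • bas l : P) : I.Cotangent) := by
    intro a h
    have h1 : (⟨∑ l, a l * (v l : R), h⟩ : I) = ∑ l, a l • v l := by
      ext; simp
    rw [h1, map_sum, AddSubmonoidClass.coe_finsetSum]
    refine Finset.sum_congr rfl fun l _ => ?_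
    rw [map_smul, hv]
    exact (algebraMap_smul B (a l) _).symm
  have hsumvI : ∀ a : Fin r → R, ∑ l, a l * (v l : R) ∈ I := fun a =>
    sum_mem fun l _ => Ideal.mul_mem_left _ _ (v l).2
  have hI2 : I ^ 2 ≤ seqIdeal x n := hI.trans_le Ideal.mul_le_left
  have hspan : Ideal.span (Set.range fun l => (v l : R)) ⊔ seqIdeal x n = I := by
    refine le_antisymm (sup_le (Ideal.span_le.mpr ?_) hQI) ?_
    · rintro _ ⟨l, rfl⟩
      exact (v l).2
    · intro z hz
      let zc := I.toCotangent ⟨z, hz⟩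
      choose a ha using fun i => Ideal.Quotient.mk_surjective (g zc i)
      choose c hc using fun l => Ideal.Quotient.mk_surjective (bas.repr (p zc) l)
      have h1 : zc = f (g zc) + (p zc : I.Cotangent) := by simp [p]
      have h2 : (p zc : I.Cotangent) = I.toCotangent ⟨_, hsumvI c⟩ := by
        rw [hvmk]
        congr 1
        conv_lhs => rw [← bas.sum_repr (p zc)]
        exact Finset.sum_congr rfl fun l _ => by rw [hc]
      have h3 : f (g zc) = I.toCotangent ⟨_, hsumI a⟩ := by
        rw [← hfmk]
        congr 1
        exact (funext ha).symm
      rw [h2, h3, ← map_add, Ideal.toCotangent_eq] at h1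
      have h4 := hI2 h1
      have h5 : ∑ i, a i * u i ∈ seqIdeal x n := by
        rw [← huspan]; exact (mem_span_range u _).mpr ⟨a, rfl⟩
      have h6 : ∑ l, c l * (v l : R) ∈ Ideal.span (Set.range fun l => (v l : R)) :=
        (mem_span_range _ _).mpr ⟨c, rfl⟩
      have h7 := add_mem (Ideal.mem_sup_right (S := Ideal.span (Set.range fun l => (v l : R)))
        (add_mem h4 h5)) (Ideal.mem_sup_left (T := seqIdeal x n) h6)
      have h8 : z = z - (∑ i, a i * u i + ∑ l, c l * (v l : R)) + ∑ i, a i * u i +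
          ∑ l, c l * (v l : R) := by ring
      rw [h8]
      exact h7
  refine ⟨r, fun l => v l, ⟨by rw [← sq, hI]; exact Ideal.mul_le_left, hspan, ?_⟩, ?_⟩
  · intro a ha
    have h0 := ha
    rw [← huspan, mem_span_range] at ha
    obtain ⟨c, hc⟩ := ha
    have h1 : I.toCotangent ⟨_, hsumI c⟩ = I.toCotangent ⟨_, hsumvI a⟩ := by
      congr 1; ext; exact hc
    rw [← hfmk, hvmk] at h1
    have h2 : (∑ l, Ideal.Quotient.mk I (a l) • bas l : P) = 0 := by
      have h3 : g ((∑ l, Ideal.Quotient.mk I (a l) • bas l : P) : I.Cotangent) = 0 :=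
        (∑ l, Ideal.Quotient.mk I (a l) • bas l : P).2
      rw [← h1, hgf] at h3
      rw [h3, map_zero] at h1
      exact Subtype.ext h1.symm
    intro l
    exact Ideal.Quotient.eq_zero_iff_mem.mp
      (Fintype.linearIndependent_iff.mp bas.linearIndependent _ h2 l)
  · have h1 : I = Submodule.span R (Set.range (Sum.elim u fun l => (v l : R))) := by
      rw [Set.Sum.elim_range, Submodule.span_union, sup_comm]
      conv_lhs => rw [← hspan, ← huspan]
    have h2 := Submodule.spanFinrank_span_le_ncard_of_finite (R := R)
      (Set.finite_range (Sum.elim u fun l => (v l : R)))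
    rw [← h1] at h2
    refine h2.trans ?_
    rw [← Set.image_univ]
    refine (Set.ncard_image_le Set.finite_univ).trans ?_
    rw [Set.ncard_univ, Nat.card_eq_fintype_card, Fintype.card_sum, hucard, Fintype.card_fin]

end RelativeBases

/-! ### The filtration of a module by powers of an ideal -/

section Engine

variable {R : Type u} [CommRing R]

/-- The module `M / K M`. -/
abbrev ModQuot (K : Ideal R) (M : Type u) [AddCommGroup M] [Module R M] : Type u :=
  M ⧸ (K • ⊤ : Submodule R M)

/-- `B` is a module killed by `I` such that maps to `B` detect all elements outside `I X`, for
every module `X`. -/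
structure IsResidueCogenerator (I : Ideal R) (B : Type u) [AddCommGroup B] [Module R B] : Prop where
  smul_eq_zero : ∀ a ∈ I, ∀ b : B, a • b = 0
  exists_ne_zero : ∀ (X : Type u) [AddCommGroup X] [Module R X] (z : X),
    z ∉ I • (⊤ : Submodule R X) → ∃ φ : X →ₗ[R] B, φ z ≠ 0

/-- A map `f : N → F` with `f⁻¹(K F) = K N`; for a presentation `0 → N → F → M → 0` with `F` flat
this says `Tor_1(M, R / K) = 0`. -/
def IsPureAt (K : Ideal R) {N F : Type u} [AddCommGroup N] [Module R N] [AddCommGroup F]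
    [Module R F] (f : N →ₗ[R] F) : Prop :=
  ∀ z : N, f z ∈ K • (⊤ : Submodule R F) → z ∈ K • (⊤ : Submodule R N)

variable {M N F X : Type u} [AddCommGroup M] [Module R M] [AddCommGroup N] [Module R N]
  [AddCommGroup F] [Module R F] [AddCommGroup X] [Module R X]

/-- `Ext^1(M, B) = 0` forces `Tor_1(M, R / I) = 0`: a functional on `N` that detects an element
of `N ∩ I F` outside `I N` could not extend to `F`. -/
theorem IsResidueCogenerator.isPureAt {I : Ideal R} {B : Type u} [AddCommGroup B] [Module R B]
    (hB : IsResidueCogenerator I B) {f : N →ₗ[R] F} {g : F →ₗ[R] M} (h : IsSES f g)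
    [Module.Projective R F] (hM : Subsingleton (ModExt R M B 1)) : IsPureAt I f := by
  intro z hz
  by_contra hzn
  obtain ⟨φ, hφ⟩ := hB.exists_ne_zero N z hzn
  obtain ⟨ψ, rfl⟩ := h.ext_one_iff.mp hM φ
  apply hφ
  have h1 := map_mem_smul_top ψ hz
  have h2 : I • (⊤ : Submodule R B) ≤ ⊥ := by
    rw [Submodule.smul_le]
    intro a ha b _
    rw [hB.smul_eq_zero a ha b]
    exact zero_mem _
  exact (Submodule.mem_bot R).mp (h2 h1)

theorem IsRelBasis.exists_sum_sub_mem {I K K' : Ideal R} {s : ℕ} {u : Fin s → R}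
    (hu : IsRelBasis I K K' u) {z : X} (hz : z ∈ K • (⊤ : Submodule R X)) :
    ∃ w : Fin s → X, z - ∑ i, u i • w i ∈ K' • (⊤ : Submodule R X) := by
  refine Submodule.smul_induction_on hz ?_ ?_
  · intro k hk y _
    rw [← hu.span_sup, Submodule.mem_sup] at hk
    obtain ⟨a, ha, k', hk', rfl⟩ := hk
    obtain ⟨c, rfl⟩ := (mem_span_range u _).mp ha
    refine ⟨fun i => c i • y, ?_⟩
    have : ∑ i, u i • c i • y = (∑ i, c i * u i) • y := by
      rw [Finset.sum_smul]
      exact Finset.sum_congr rfl fun i _ => by rw [smul_smul, mul_comm]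
    rw [this, add_smul, add_sub_cancel_left]
    exact Submodule.smul_mem_smul hk' trivial
  · rintro y y' ⟨w, hw⟩ ⟨w', hw'⟩
    refine ⟨w + w', ?_⟩
    have : y + y' - ∑ i, u i • (w + w') i = (y - ∑ i, u i • w i) + (y' - ∑ i, u i • w' i) := by
      simp only [Pi.add_apply, smul_add, Finset.sum_add_distrib]
      abel
    rw [this]
    exact add_mem hw hw'

theorem IsRelBasis.smul_mem {I K K' : Ideal R} {s : ℕ} {u : Fin s → R}
    (hu : IsRelBasis I K K' u) (i : Fin s) {z : X} (hz : z ∈ I • (⊤ : Submodule R X)) :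
    u i • z ∈ K' • (⊤ : Submodule R X) := by
  have h1 : u i • z ∈ K • I • (⊤ : Submodule R X) := Submodule.smul_mem_smul (hu.mem i) hz
  rw [← Submodule.mul_smul, mul_comm] at h1
  exact Submodule.smul_mono_left hu.mul_le h1

theorem IsRelBasis.mem_of_sum_mem_pi {I K K' : Ideal R} {s m : ℕ} {u : Fin s → R}
    (hu : IsRelBasis I K K' u) {w : Fin s → Fin m → R}
    (h : ∑ i, u i • w i ∈ K' • (⊤ : Submodule R (Fin m → R))) (i : Fin s) :
    w i ∈ I • (⊤ : Submodule R (Fin m → R)) := by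
  rw [mem_smul_top_pi] at h ⊢
  intro j
  refine hu.indep (fun i => w i j) ?_ i
  have := h j
  simpa [Finset.sum_apply, mul_comm] using this

/-- Vanishing of `Tor_1(M, -)` on `R / I` passes down along `K / K'`, which is a sum of copies of
`R / I`. -/
theorem IsRelBasis.isPureAt {I K K' : Ideal R} {s m : ℕ} {u : Fin s → R}
    (hu : IsRelBasis I K K' u) {f : N →ₗ[R] (Fin m → R)} (hI : IsPureAt I f)
    (hK : IsPureAt K f) : IsPureAt K' f := by
  intro z hz
  obtain ⟨w, hw⟩ := hu.exists_sum_sub_mem (hK z (Submodule.smul_mono_left hu.le hz))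
  have h1 : ∑ i, u i • f (w i) ∈ K' • (⊤ : Submodule R (Fin m → R)) := by
    have := sub_mem hz (map_mem_smul_top f hw)
    simpa [map_sub, map_sum] using this
  have h2 : ∑ i, u i • w i ∈ K' • (⊤ : Submodule R N) :=
    sum_mem fun i _ => hu.smul_mem i (hI _ (hu.mem_of_sum_mem_pi h1 i))
  simpa using add_mem hw h2

/-- The map `(M / I M)^s → M / K' M` given by multiplication with a basis of `K / K'`. -/
noncomputable def IsRelBasis.layerMap {I K K' : Ideal R} {s : ℕ} {u : Fin s → R}
    (hu : IsRelBasis I K K' u) (M : Type u) [AddCommGroup M] [Module R M] :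
    (Fin s → ModQuot I M) →ₗ[R] ModQuot K' M :=
  ∑ i, (Submodule.mapQ (I • ⊤ : Submodule R M) (K' • ⊤ : Submodule R M) (LinearMap.lsmul R M (u i))
    fun _ hz => hu.smul_mem i hz) ∘ₗ LinearMap.proj i

theorem IsRelBasis.layerMap_mk {I K K' : Ideal R} {s : ℕ} {u : Fin s → R}
    (hu : IsRelBasis I K K' u) (w : Fin s → M) :
    hu.layerMap M (fun i => Submodule.Quotient.mk (w i)) =
      Submodule.Quotient.mk (∑ i, u i • w i) := by
  simp only [layerMap, LinearMap.sum_apply, LinearMap.comp_apply, LinearMap.proj_apply]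
  exact (map_sum (Submodule.mkQ (K' • ⊤ : Submodule R M)) _ _).symm

/-- The layer `K M / K' M` of a module `M` is `(M / I M)^s` whenever `M` has a presentation that
is pure at `K`. -/
theorem IsRelBasis.isSES_layer {I K K' : Ideal R} {s m : ℕ} {u : Fin s → R}
    (hu : IsRelBasis I K K' u) {f : N →ₗ[R] (Fin m → R)} {g : (Fin m → R) →ₗ[R] M}
    (h : IsSES f g) (hK : IsPureAt K f) :
    IsSES (hu.layerMap M)
      (Submodule.factor (Submodule.smul_mono_left hu.le) : ModQuot K' M →ₗ[R] ModQuot K M) where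
  inj := by
    rw [← LinearMap.ker_eq_bot, LinearMap.ker_eq_bot']
    intro b hb
    choose w hw using fun i => Submodule.mkQ_surjective _ (b i)
    obtain rfl : (fun i => Submodule.Quotient.mk (w i)) = b := funext hw
    rw [hu.layerMap_mk, Submodule.Quotient.mk_eq_zero] at hb
    choose v hv using fun i => h.surj (w i)
    have hmap : K' • (⊤ : Submodule R M) = (K' • (⊤ : Submodule R (Fin m → R))).map g := by
      rw [Submodule.map_smul'', Submodule.map_top, LinearMap.range_eq_top.mpr h.surj]
    rw [hmap] at hb
    obtain ⟨q, hq, hqe⟩ := hb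
    obtain ⟨z, hz⟩ := (h.exact (∑ i, u i • v i - q)).mp (by
      rw [map_sub, hqe, map_sum, sub_eq_zero]
      exact Finset.sum_congr rfl fun i _ => by rw [map_smul, hv])
    have hzK : z ∈ K • (⊤ : Submodule R N) := by
      refine hK z ?_
      rw [hz]
      exact sub_mem (sum_mem fun i _ => Submodule.smul_mem_smul (hu.mem i) trivial)
        (Submodule.smul_mono_left hu.le hq)
    obtain ⟨ω, hω⟩ := hu.exists_sum_sub_mem hzK
    have h1 : ∑ i, u i • (v i - f (ω i)) ∈ K' • (⊤ : Submodule R (Fin m → R)) := by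
      have h2 := add_mem hq (map_mem_smul_top f hω)
      rw [map_sub, hz, map_sum] at h2
      have h3 : ∑ i, u i • (v i - f (ω i)) =
          q + (∑ i, u i • v i - q - ∑ i, f (u i • ω i)) := by
        simp only [smul_sub, Finset.sum_sub_distrib, map_smul]
        abel
      rw [h3]
      exact h2
    ext i
    have h4 := map_mem_smul_top g (hu.mem_of_sum_mem_pi h1 i)
    rw [map_sub, h.apply_apply, sub_zero, hv] at h4
    exact (Submodule.Quotient.mk_eq_zero _).mpr h4
  surj := Submodule.factor_surjective _
  exact := by
    intro z
    obtain ⟨z, rfl⟩ := Submodule.mkQ_surjective _ z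
    rw [Submodule.factor_mk, Submodule.mkQ_apply, Submodule.Quotient.mk_eq_zero]
    constructor
    · intro hz
      obtain ⟨w, hw⟩ := hu.exists_sum_sub_mem hz
      refine ⟨fun i => Submodule.Quotient.mk (w i), ?_⟩
      rw [hu.layerMap_mk, eq_comm, Submodule.mkQ_apply, Submodule.Quotient.eq]
      exact hw
    · rintro ⟨b, hb⟩
      choose w hw using fun i => Submodule.mkQ_surjective _ (b i)
      obtain rfl : (fun i => Submodule.Quotient.mk (w i)) = b := funext hw
      rw [hu.layerMap_mk, eq_comm, Submodule.mkQ_apply, Submodule.Quotient.eq] at hb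
      have h1 : ∑ i, u i • w i ∈ K • (⊤ : Submodule R M) :=
        sum_mem fun i _ => Submodule.smul_mem_smul (hu.mem i) trivial
      simpa using add_mem (Submodule.smul_mono_left hu.le hb) h1

/-- The layers `I^j / I^{j+1}` for `j < l` are free over `R / I`, of rank `s j`. -/
def HasFreeLayers (I : Ideal R) (s : ℕ → ℕ) (l : ℕ) : Prop :=
  ∀ j < l, ∃ u : Fin (s j) → R, IsRelBasis I (I ^ j) (I ^ (j + 1)) u

theorem HasFreeLayers.isPureAt {I : Ideal R} {s : ℕ → ℕ} {l m : ℕ} (hs : HasFreeLayers I s l)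
    {f : N →ₗ[R] (Fin m → R)} (hI : IsPureAt I f) {j : ℕ} (hj : j ≤ l) : IsPureAt (I ^ j) f := by
  induction j with
  | zero => intro z _; simp
  | succ j ih =>
    obtain ⟨u, hu⟩ := hs j hj
    exact hu.isPureAt hI (ih (by omega))

/-- The layers `I^j M / I^{j+1} M` for `j < l` are sums of `s j` copies of `M / I M`, stated through
the short exact sequences `0 → (M / I M)^{s j} → M / I^{j+1} M → M / I^j M → 0`. -/
def HasLayers (I : Ideal R) (s : ℕ → ℕ) (l : ℕ) (M : Type u) [AddCommGroup M] [Module R M] : Prop :=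
  ∀ j < l, ∃ (f : (Fin (s j) → ModQuot I M) →ₗ[R] ModQuot (I ^ (j + 1)) M)
    (g : ModQuot (I ^ (j + 1)) M →ₗ[R] ModQuot (I ^ j) M), IsSES f g

theorem HasFreeLayers.hasLayers {I : Ideal R} {s : ℕ → ℕ} {l : ℕ} (hs : HasFreeLayers I s l)
    {B : Type u} [AddCommGroup B] [Module R B] (hB : IsResidueCogenerator I B)
    [Module.Finite R M] (hM : Subsingleton (ModExt R M B 1)) : HasLayers I s l M := by
  intro j hj
  obtain ⟨m, g, hg⟩ := exists_free_presentation R M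
  have h := IsSES.ker hg
  have hI := hB.isPureAt h hM
  obtain ⟨u, hu⟩ := hs j hj
  exact ⟨_, _, hu.isSES_layer h (hs.isPureAt hI hj.le)⟩

theorem IsRelBasis.exists_isSES {I K' : Ideal R} {s : ℕ} {u : Fin s → R}
    (hu : IsRelBasis I I K' u) {B : Type u} [AddCommGroup B] [Module R B]
    (hB : IsResidueCogenerator I B)
    [Module.Finite R M] (hM : Subsingleton (ModExt R M B 1)) :
    ∃ (f : (Fin s → ModQuot I M) →ₗ[R] ModQuot K' M) (g : ModQuot K' M →ₗ[R] ModQuot I M),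
      IsSES f g := by
  obtain ⟨m, g, hg⟩ := exists_free_presentation R M
  have h := IsSES.ker hg
  have hI := hB.isPureAt h hM
  exact ⟨_, _, hu.isSES_layer h hI⟩

namespace HasLayers

variable {I : Ideal R} {s : ℕ → ℕ} {l : ℕ}

theorem extLength_le (h : HasLayers I s l M) (X : Type u) [AddCommGroup X] [Module R X]
    (i : ℕ) {j : ℕ} (hj : j ≤ l) :
    extLength R X (ModQuot (I ^ j) M) i ≤
      ((∑ k ∈ Finset.range j, s k : ℕ) : ℕ∞) * extLength R X (ModQuot I M) i := by
  induction j with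
  | zero =>
    have : Subsingleton (ModQuot (I ^ 0) M) :=
      Submodule.Quotient.subsingleton_iff.mpr (by simp)
    rw [extLength_eq_zero_iff.mpr (ModExt.subsingleton_of_subsingleton_right i)]
    exact zero_le
  | succ j ih =>
    obtain ⟨f, g, hfg⟩ := h j hj
    refine (hfg.extLength_mid_le i).trans ?_
    rw [extLength_pi, Finset.sum_range_succ, Nat.cast_add, add_mul, add_comm]
    exact add_le_add (ih (by omega)) le_rfl

theorem ext_eq_zero (h : HasLayers I s l M) {i : ℕ}
    (hi : Subsingleton (ModExt R X (ModQuot I M) i)) :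
    Subsingleton (ModExt R X (ModQuot (I ^ l) M) i) := by
  rw [← extLength_eq_zero_iff] at hi ⊢
  have := h.extLength_le X i le_rfl
  rw [hi, mul_zero] at this
  exact le_antisymm this (zero_le)

/-- When `Ext^{i+1}(X, M / I^{l+1} M)` vanishes, `Ext^{i+1}` of the bottom layer is a quotient of
`Ext^i(X, M / I^l M)`. If the bottom layer has larger rank than the others together, the lengths of
`Ext^i(X, M / I M)` therefore decrease strictly until they reach `0`. -/
theorem mul_extLength_succ_le (h : HasLayers I s (l + 1) M) {i : ℕ}
    (hi : Subsingleton (ModExt R X (ModQuot (I ^ (l + 1)) M) (i + 1))) :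
    (s l : ℕ∞) * extLength R X (ModQuot I M) (i + 1) ≤
      ((∑ k ∈ Finset.range l, s k : ℕ) : ℕ∞) * extLength R X (ModQuot I M) i := by
  obtain ⟨f, g, hfg⟩ := h l l.lt_succ_self
  rw [← extLength_pi]
  exact (hfg.extLength_succ_le hi).trans (h.extLength_le X i l.le_succ)

/-- If `Ext^{i+1}(X, M / I M) = 0`, then `Ext^i(X, -)` is right exact on the filtration, so the
quotient `M / I M` of `M / I^l M` inherits the vanishing of `Ext^i`. -/
theorem ext_descend (h : HasLayers I s l M) (hl : 0 < l) {i : ℕ}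
    (hi : Subsingleton (ModExt R X (ModQuot (I ^ l) M) i))
    (hi' : Subsingleton (ModExt R X (ModQuot I M) (i + 1))) :
    Subsingleton (ModExt R X (ModQuot I M) i) := by
  induction l with
  | zero => omega
  | succ l ih =>
    rcases Nat.eq_zero_or_pos l with rfl | hl'
    · rw [zero_add, pow_one] at hi
      exact hi
    · refine ih (fun j hj => h j (by omega)) hl' ?_
      obtain ⟨f, g, hfg⟩ := h l l.lt_succ_self
      exact hfg.ext_right hi (ModExt.subsingleton_pi hi')

end HasLayers

/-- A sequence of finite lengths that shrinks by a factor less than `1` at each step vanishes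
eventually. -/
theorem eventually_eq_zero_of_mul_le {e : ℕ → ℕ∞} {s σ a : ℕ} (hσ : σ < s)
    (he : ∀ i, e i ≠ ⊤) (h : ∀ i, a < i → (s : ℕ∞) * e (i + 1) ≤ (σ : ℕ∞) * e i) :
    ∃ N, ∀ i, N < i → e i = 0 := by
  choose c hc using fun i => ENat.ne_top_iff_exists.mp (he i)
  have h' : ∀ i, a < i → s * c (i + 1) ≤ σ * c i := fun i hi => by
    have := h i hi
    rw [← hc, ← hc] at this
    exact_mod_cast this
  have key : ∀ k, c (a + 1 + k) ≤ c (a + 1) - k := by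
    intro k
    induction k with
    | zero => simp
    | succ k ih =>
      have h1 := h' (a + 1 + k) (by omega)
      rw [← add_assoc]
      rcases Nat.eq_zero_or_pos (c (a + 1 + k)) with h0 | h0
      · rw [h0, mul_zero, Nat.le_zero, mul_eq_zero] at h1
        rw [h1.resolve_left (by omega)]
        exact Nat.zero_le _
      · have h2 : c (a + 1 + k + 1) < c (a + 1 + k) := by
          by_contra hcon
          push Not at hcon
          have h3 : s * c (a + 1 + k) ≤ s * c (a + 1 + k + 1) := Nat.mul_le_mul_left s hcon
          have h4 : σ * c (a + 1 + k) < s * c (a + 1 + k) := Nat.mul_lt_mul_of_pos_right hσ h0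
          omega
        omega
  refine ⟨a + 1 + c (a + 1), fun i hi => ?_⟩
  have h1 := key (i - (a + 1))
  have h2 : a + 1 + (i - (a + 1)) = i := by omega
  rw [h2] at h1
  rw [← hc, show c i = 0 by omega]
  rfl

end Engine

/-! ### Change of rings -/

section BaseChange

variable {R : Type u} [CommRing R] {C : Type u} [CommRing C] [Algebra R C]

/-- For a surjection `R → C` with kernel `K`, the base change `C ⊗ Z` is `Z / K Z`. -/
theorem one_tmul_eq_zero_iff (hsurj : Function.Surjective (algebraMap R C)) {K : Ideal R}
    (hK : RingHom.ker (algebraMap R C) = K) {Z : Type u} [AddCommGroup Z] [Module R Z] (z : Z) :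
    (1 : C) ⊗ₜ[R] z = 0 ↔ z ∈ K • (⊤ : Submodule R Z) := by
  subst hK
  let e := (Ideal.quotientKerAlgEquivOfSurjective (f := Algebra.ofId R C) hsurj).toLinearEquiv
  have he : e (1 : R ⧸ RingHom.ker (Algebra.ofId R C)) = 1 :=
    map_one (Ideal.quotientKerAlgEquivOfSurjective (f := Algebra.ofId R C) hsurj)
  let e' := (TensorProduct.congr e.symm (LinearEquiv.refl R Z)).trans
    (TensorProduct.quotTensorEquivQuotSMul Z (RingHom.ker (Algebra.ofId R C)))
  have h1 : e' ((1 : C) ⊗ₜ z) = Submodule.Quotient.mk z := by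
    have h2 : e.symm 1 = Ideal.Quotient.mk _ 1 := by
      rw [LinearEquiv.symm_apply_eq, map_one, he]
    simp only [e', LinearEquiv.trans_apply, TensorProduct.congr_tmul, h2,
      LinearEquiv.refl_apply]
    rw [TensorProduct.quotTensorEquivQuotSMul_mk_tmul, one_smul]
  rw [← e'.map_eq_zero_iff, h1, Submodule.Quotient.mk_eq_zero]
  rfl

theorem exists_one_tmul (hsurj : Function.Surjective (algebraMap R C)) {Z : Type u}
    [AddCommGroup Z] [Module R Z] (y : C ⊗[R] Z) : ∃ z : Z, (1 : C) ⊗ₜ[R] z = y := by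
  induction y with
  | zero => exact ⟨0, by simp⟩
  | tmul c z =>
    obtain ⟨r, rfl⟩ := hsurj c
    refine ⟨r • z, ?_⟩
    rw [TensorProduct.tmul_smul, TensorProduct.smul_tmul', Algebra.algebraMap_eq_smul_one]
  | add y y' h h' =>
    obtain ⟨z, rfl⟩ := h
    obtain ⟨z', rfl⟩ := h'
    exact ⟨z + z', by rw [TensorProduct.tmul_add]⟩

/-- `C ⊗ Z ≃ Z / K Z` for a surjection `R → C` with kernel `K`. -/
theorem exists_equiv_modQuot (hsurj : Function.Surjective (algebraMap R C)) {K : Ideal R}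
    (hK : RingHom.ker (algebraMap R C) = K) (Z : Type u) [AddCommGroup Z] [Module R Z] :
    Nonempty (ModQuot K Z ≃ₗ[R] C ⊗[R] Z) := by
  let f : Z →ₗ[R] C ⊗[R] Z := TensorProduct.mk R C Z 1
  have hker : LinearMap.ker f = K • ⊤ := by
    ext z
    rw [LinearMap.mem_ker]
    exact one_tmul_eq_zero_iff hsurj hK z
  exact ⟨(Submodule.quotEquivOfEq _ _ hker.symm).trans
    (f.quotKerEquivOfSurjective fun y => exists_one_tmul hsurj y)⟩

/-- Over a ring map `R → B` onto a self-injective Artinian local ring, `B` detects elements. -/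
theorem isResidueCogenerator_of_injective [IsLocalRing C] [IsArtinianRing C] [Module.Injective C C]
    (hsurj : Function.Surjective (algebraMap R C)) {I : Ideal R}
    (hI : RingHom.ker (algebraMap R C) = I) : IsResidueCogenerator I C where
  smul_eq_zero a ha b := by
    rw [← hI, RingHom.mem_ker] at ha
    rw [Algebra.smul_def, ha, zero_mul]
  exists_ne_zero X _ _ z hz := by
    rw [← one_tmul_eq_zero_iff hsurj hI] at hz
    obtain ⟨φ, hφ⟩ := exists_functional_ne_zero (B := C) hz
    exact ⟨φ.restrictScalars R ∘ₗ TensorProduct.mk R C X 1, hφ⟩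

theorem IsSES.baseChange (hsurj : Function.Surjective (algebraMap R C)) {K : Ideal R}
    (hK : RingHom.ker (algebraMap R C) = K) {N F M : Type u} [AddCommGroup N] [Module R N]
    [AddCommGroup F] [Module R F] [AddCommGroup M] [Module R M] {f : N →ₗ[R] F} {g : F →ₗ[R] M}
    (h : IsSES f g) (hf : IsPureAt K f) : IsSES (f.baseChange C) (g.baseChange C) where
  inj := by
    rw [← LinearMap.ker_eq_bot, LinearMap.ker_eq_bot']
    intro y hy
    obtain ⟨z, rfl⟩ := exists_one_tmul hsurj y
    rw [LinearMap.baseChange_tmul, one_tmul_eq_zero_iff hsurj hK] at hy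
    exact (one_tmul_eq_zero_iff hsurj hK z).mpr (hf z hy)
  surj := LinearMap.lTensor_surjective C h.surj
  exact := lTensor_exact C h.exact h.surj

/-- Change of rings: if `M` is `Tor`-independent of `C = R / K` (which follows from the vanishing of
all `Ext^i(M, B)`), then `Ext_R(M, X)` and `Ext_C(C ⊗ M, X)` vanish in the same degrees. -/
theorem ext_baseChange_iff [IsNoetherianRing R] (hsurj : Function.Surjective (algebraMap R C))
    {I : Ideal R} {s : ℕ → ℕ} {l : ℕ} (hs : HasFreeLayers I s l)
    (hK : RingHom.ker (algebraMap R C) = I ^ l)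
    {B : Type u} [AddCommGroup B] [Module R B] (hB : IsResidueCogenerator I B)
    (X : Type u) [AddCommGroup X] [Module R X] [Module C X] [IsScalarTower R C X]
    (i : ℕ) (M : Type u) [AddCommGroup M] [Module R M] [Module.Finite R M]
    (hM : ∀ i, Subsingleton (ModExt R M B (i + 1))) :
    Subsingleton (ModExt R M X (i + 1)) ↔ Subsingleton (ModExt C (C ⊗[R] M) X (i + 1)) := by
  induction i generalizing M with
  | zero =>
    obtain ⟨m, g, hg⟩ := exists_free_presentation R M
    have h := IsSES.ker hg
    have h' := h.baseChange hsurj hK (hs.isPureAt (hB.isPureAt h (hM 0)) le_rfl)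
    rw [h.ext_one_iff, h'.ext_one_iff]
    constructor
    · intro H φ
      obtain ⟨ψ, hψ⟩ := H (φ.restrictScalars R ∘ₗ TensorProduct.mk R C _ 1)
      refine ⟨ψ.liftBaseChange C, LinearMap.ext fun y => ?_⟩
      obtain ⟨z, rfl⟩ := exists_one_tmul hsurj y
      have := LinearMap.congr_fun hψ z
      simpa using this
    · intro H φ
      obtain ⟨ψ, hψ⟩ := H (φ.liftBaseChange C)
      refine ⟨ψ.restrictScalars R ∘ₗ TensorProduct.mk R C _ 1, LinearMap.ext fun z => ?_⟩
      have := LinearMap.congr_fun hψ (1 ⊗ₜ z)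
      simpa using this
  | succ i ih =>
    obtain ⟨m, g, hg⟩ := exists_free_presentation R M
    have h := IsSES.ker hg
    have h' := h.baseChange hsurj hK (hs.isPureAt (hB.isPureAt h (hM 0)) le_rfl)
    rw [h.ext_shift, h'.ext_shift]
    exact ih _ fun k => (h.ext_shift k).mp (hM (k + 1))

end BaseChange

/-! ### Syzygies -/

section Syzygies

variable {R : Type u} [CommRing R]

/-- Passing to a `k`-th syzygy preserves the vanishing of `Ext^i(M, R)` and the degrees in which
`Ext^i(M, M)` vanishes: `Ext^i(M, M) = Ext^{i+1}(M, ΩM) = Ext^i(ΩM, ΩM)`. -/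
theorem exists_syzygy [IsNoetherianRing R] (k : ℕ) (M : Type u) [AddCommGroup M] [Module R M]
    [Module.Finite R M] (hM : ∀ i, 0 < i → Subsingleton (ModExt R M R i)) :
    ∃ (N : Type u) (_ : AddCommGroup N) (_ : Module R N), Module.Finite R N ∧
      (∀ i, 0 < i → Subsingleton (ModExt R N R i)) ∧
      (∀ i, 0 < i → (Subsingleton (ModExt R M M i) ↔ Subsingleton (ModExt R N N i))) ∧
      (∀ (X : Type u) [AddCommGroup X] [Module R X] (i : ℕ), 0 < i →
        (Subsingleton (ModExt R M X (i + k)) ↔ Subsingleton (ModExt R N X i))) ∧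
      (∀ (x : ℕ → R) (n : ℕ), k ≤ n → IsRegularOn x n R → IsRegularOn x k N) := by
  induction k with
  | zero =>
    exact ⟨M, inferInstance, inferInstance, inferInstance, hM, fun _ _ => Iff.rfl,
      fun _ _ _ _ _ => Iff.rfl, fun _ _ _ _ j hj => absurd hj (Nat.not_lt_zero j)⟩
  | succ k ih =>
    obtain ⟨N, _, _, _, h1, h2, h3, h4⟩ := ih
    obtain ⟨m, g, hg⟩ := exists_free_presentation R N
    have h := IsSES.ker hg
    refine ⟨LinearMap.ker g, inferInstance, inferInstance, inferInstance, ?_, ?_, ?_, ?_⟩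
    · intro i hi
      obtain ⟨i, rfl⟩ := Nat.exists_eq_add_one_of_ne_zero hi.ne'
      exact (h.ext_shift i).mp (h1 _ (Nat.succ_pos _))
    · intro i hi
      rw [h2 i hi]
      obtain ⟨i, rfl⟩ := Nat.exists_eq_add_one_of_ne_zero hi.ne'
      rw [← h.ext_shift]
      have hF : ∀ i, Subsingleton (ModExt R N (Fin m → R) (i + 1)) := fun i =>
        ModExt.subsingleton_pi (h1 _ (Nat.succ_pos _))
      exact ⟨fun h5 => h.ext_left h5 (hF _), fun h5 => h.ext_right (hF _) h5⟩
    · intro X _ _ i hi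
      have h5 : i + (k + 1) = (i + 1) + k := by omega
      rw [h5, h3 X (i + 1) (Nat.succ_pos _)]
      obtain ⟨i, rfl⟩ := Nat.exists_eq_add_one_of_ne_zero hi.ne'
      exact h.ext_shift i
    · intro x n hk hx
      exact (hx.pi m).syzygy h (h4 x n (by omega) hx) hk

end Syzygies

/-! ### Transfer of the symmetric Auslander condition -/

section Transfer

variable {R : Type u} [CommRing R]

theorem isArtinian_modQuot [IsNoetherianRing R] {B : Type u} [CommRing B] [Algebra R B]
    [IsArtinianRing B] (hsurj : Function.Surjective (algebraMap R B)) {I : Ideal R}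
    (hI : RingHom.ker (algebraMap R B) = I) (M : Type u) [AddCommGroup M] [Module R M]
    [Module.Finite R M] : IsArtinian R (ModQuot I M) := by
  obtain ⟨e⟩ := exists_equiv_modQuot hsurj hI M
  have h1 : IsArtinian R (B ⊗[R] M) := by
    have : IsArtinian B (B ⊗[R] M) := inferInstance
    exact isArtinian_of_surjective_algebraMap hsurj
  exact isArtinian_of_linearEquiv e.symm

/-- Suppose `W` is an extension of `Y` by `Y^r` with `r ≥ 2` and `Y` has finite length. If
`Ext^i(X, W)` vanishes for `i > a`, so does `Ext^i(X, Y)`: the lengths satisfy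
`e_i = r e_{i+1}`. -/
theorem IsSES.ext_eq_zero_of_two_le [IsNoetherianRing R] {W X Y : Type u} [AddCommGroup W]
    [Module R W] [AddCommGroup X] [Module R X] [AddCommGroup Y] [Module R Y] [Module.Finite R X]
    [Module.Finite R Y] [IsArtinian R Y] {r : ℕ} (hr : 2 ≤ r) {f : (Fin r → Y) →ₗ[R] W}
    {g : W →ₗ[R] Y} (h : IsSES f g) {a : ℕ}
    (hW : ∀ i, a < i → Subsingleton (ModExt R X W i)) (i : ℕ) (hi : a < i) :
    Subsingleton (ModExt R X Y i) := by
  obtain ⟨N, hN⟩ := eventually_eq_zero_of_mul_le (e := extLength R X Y) (s := r) (σ := 1) (a := a)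
    hr extLength_ne_top fun i hi => by
      rw [← extLength_pi, Nat.cast_one, one_mul]
      exact h.extLength_succ_le (hW _ (by omega))
  have key : ∀ k i, a < i → N < i + k → Subsingleton (ModExt R X Y i) := by
    intro k
    induction k with
    | zero => intro i _ hNi; exact extLength_eq_zero_iff.mp (hN i hNi)
    | succ k ih =>
      intro i hi hNi
      exact h.ext_right (hW i hi) (ModExt.subsingleton_pi (ih (i + 1) (by omega) (by omega)))
  exact key (N + 1) i hi (by omega)

theorem HasFreeLayers.mono {I : Ideal R} {s : ℕ → ℕ} {l l' : ℕ} (h : HasFreeLayers I s l)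
    (hl : l' ≤ l) : HasFreeLayers I s l' := fun j hj => h j (hj.trans_le hl)

theorem exists_equiv_modQuot_self {B : Type u} [CommRing B] [Algebra R B]
    (hsurj : Function.Surjective (algebraMap R B)) {I : Ideal R}
    (hI : RingHom.ker (algebraMap R B) = I) : Nonempty (ModQuot I R ≃ₗ[R] B) := by
  obtain ⟨e⟩ := exists_equiv_modQuot hsurj hI R
  exact ⟨e.trans (TensorProduct.rid R B)⟩

/-- Going up: if the layers of the nilpotent ideal `I` are free over `B = R / I` and the bottom
layer outweighs all the others, then (SAC) passes from `B` to `R`. -/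
theorem SatisfiesSAC.of_quotient [IsNoetherianRing R] {B : Type u} [CommRing B] [Algebra R B]
    [IsLocalRing B] [IsArtinianRing B] [Module.Injective B B]
    (hsurj : Function.Surjective (algebraMap R B)) {I : Ideal R}
    (hI : RingHom.ker (algebraMap R B) = I) {s : ℕ → ℕ} {l : ℕ} (hs : HasFreeLayers I s (l + 1))
    (hnil : I ^ (l + 1) = ⊥) (hlt : ∑ k ∈ Finset.range l, s k < s l) (hB : SatisfiesSAC B) :
    SatisfiesSAC R := by
  have hcog : IsResidueCogenerator I B := isResidueCogenerator_of_injective hsurj hI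
  have hart : ∀ (M : Type u) [AddCommGroup M] [Module R M] [Module.Finite R M],
      IsArtinian R (ModQuot I M) := fun M _ _ _ => isArtinian_modQuot hsurj hI M
  obtain ⟨eB⟩ := exists_equiv_modQuot_self hsurj hI
  have enil : ∀ (M : Type u) [AddCommGroup M] [Module R M],
      Nonempty (ModQuot (I ^ (l + 1)) M ≃ₗ[R] M) := fun M _ _ =>
    ⟨Submodule.quotEquivOfEqBot _ (by rw [hnil, Submodule.bot_smul])⟩
  -- if `Ext^i(X, M)` vanishes eventually, so does `Ext^i(X, M / I M)`
  have hev : ∀ (X M : Type u) [AddCommGroup X] [Module R X] [AddCommGroup M] [Module R M]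
      [Module.Finite R X] [Module.Finite R M] (a : ℕ), HasLayers I s (l + 1) M →
      (∀ i, a < i → Subsingleton (ModExt R X M i)) →
      ∃ N, ∀ i, N < i → Subsingleton (ModExt R X (ModQuot I M) i) := by
    intro X M _ _ _ _ _ _ a hM hX
    have := hart M
    obtain ⟨e⟩ := enil M
    obtain ⟨N, hN⟩ := eventually_eq_zero_of_mul_le (e := extLength R X (ModQuot I M)) (a := a) hlt
      extLength_ne_top fun i hi => hM.mul_extLength_succ_le
        (ModExt.congr_right e.symm (hX (i + 1) (by omega)))
    exact ⟨N, fun i hi => extLength_eq_zero_iff.mp (hN i hi)⟩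
  intro M _ _ _ hMR hMM
  have hlayR : HasLayers I s (l + 1) R :=
    hs.hasLayers hcog (ModExt.subsingleton_of_projective B 0)
  obtain ⟨t, ht⟩ := hev M R 0 hlayR hMR
  -- beyond degree `t` all `Ext^i(M, R / I)` vanish, so for the `t`-th syzygy they all vanish
  obtain ⟨N, _, _, _, hNR, hNN, hNX, -⟩ := exists_syzygy t M hMR
  have hNB : ∀ i, Subsingleton (ModExt R N B (i + 1)) := fun i =>
    ModExt.congr_right eB ((hNX _ (i + 1) (Nat.succ_pos i)).mp (ht _ (by omega)))
  have hlayN : HasLayers I s (l + 1) N := hs.hasLayers hcog (hNB 0)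
  obtain ⟨a, ha⟩ := hMM
  obtain ⟨a', ha'⟩ := hev N N a hlayN fun i hi => (hNN i (by omega)).mp (ha i hi)
  obtain ⟨eN⟩ := exists_equiv_modQuot hsurj hI N
  have hbc := fun (X : Type u) [AddCommGroup X] [Module R X] [Module B X] [IsScalarTower R B X]
      (i : ℕ) => ext_baseChange_iff hsurj (hs.mono (Nat.succ_le_succ (Nat.zero_le l)))
        (hI.trans (pow_one I).symm) hcog X i N hNB
  have hfinal := hB (B ⊗[R] N)
    (fun i hi => by
      obtain ⟨i, rfl⟩ := Nat.exists_eq_add_one_of_ne_zero hi.ne'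
      exact (hbc B i).mp (hNB i))
    ⟨a', fun i hi => by
      obtain ⟨i, rfl⟩ := Nat.exists_eq_add_one_of_ne_zero (by omega : i ≠ 0)
      exact (hbc (B ⊗[R] N) i).mp (ModExt.congr_right eN (ha' _ hi))⟩
  intro i hi
  refine (hNN i hi).mpr ?_
  obtain ⟨i, rfl⟩ := Nat.exists_eq_add_one_of_ne_zero hi.ne'
  obtain ⟨e⟩ := enil N
  exact ModExt.congr_right e (hlayN.ext_eq_zero
    (ModExt.congr_right eN.symm ((hbc (B ⊗[R] N) i).mpr (hfinal (i + 1) hi))))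

/-- Going down: let `Q ≤ I` be generated by a regular sequence such that `I / Q` is free of rank at
least `2` over `B = R / I`, and let the layers of `I` be free over `B`. Then (SAC) passes from
`C = R / I^l` to `R`. -/
theorem SatisfiesSAC.of_quotient_pow [IsNoetherianRing R] [IsLocalRing R]
    {B : Type u} [CommRing B] [Algebra R B]
    [IsLocalRing B] [IsArtinianRing B] [Module.Injective B B]
    (hsurj : Function.Surjective (algebraMap R B)) {I : Ideal R}
    (hI : RingHom.ker (algebraMap R B) = I) {x : ℕ → R} {n : ℕ} (hx : IsRegularOn x n R)
    (hxm : ∀ k < n, x k ∈ IsLocalRing.maximalIdeal R) {r : ℕ} (hr : 2 ≤ r) {v : Fin r → R}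
    (hv : IsRelBasis I I (seqIdeal x n) v) {s : ℕ → ℕ} {l : ℕ} (hl : 0 < l)
    (hs : HasFreeLayers I s l) {C : Type u} [CommRing C] [Algebra R C]
    (hsurjC : Function.Surjective (algebraMap R C)) (hC : RingHom.ker (algebraMap R C) = I ^ l)
    (hSAC : SatisfiesSAC C) : SatisfiesSAC R := by
  have hcog : IsResidueCogenerator I B := isResidueCogenerator_of_injective hsurj hI
  have hart : ∀ (M : Type u) [AddCommGroup M] [Module R M] [Module.Finite R M],
      IsArtinian R (ModQuot I M) := fun M _ _ _ => isArtinian_modQuot hsurj hI M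
  obtain ⟨eB⟩ := exists_equiv_modQuot_self hsurj hI
  obtain ⟨eC⟩ := exists_equiv_modQuot_self hsurjC hC
  intro M _ _ _ hMR hMM
  -- the `n`-th syzygy is used to make `x` regular on the module
  obtain ⟨N, _, _, _, hNR, hNN, -, hNreg⟩ := exists_syzygy n M hMR
  have hreg : IsRegularOn x n N := hNreg x n le_rfl hx
  obtain ⟨a, ha⟩ := hMM
  have hRB : ∀ i, Subsingleton (ModExt R R B (i + 1)) := ModExt.subsingleton_of_projective B
  have hNB' : ∀ i, 0 < i → Subsingleton (ModExt R N (ModQuot I R) i) := by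
    obtain ⟨f, g, hfg⟩ := hv.exists_isSES (M := R) hcog (hRB 0)
    have := hart R
    exact hfg.ext_eq_zero_of_two_le hr (hx.ext_seqQuot hNR le_rfl)
  have hNB : ∀ i, Subsingleton (ModExt R N B (i + 1)) := fun i =>
    ModExt.congr_right eB (hNB' (i + 1) (Nat.succ_pos i))
  obtain ⟨f, g, hfg⟩ := hv.exists_isSES (M := N) hcog (hNB 0)
  have hNI : ∀ i, a < i → Subsingleton (ModExt R N (ModQuot I N) i) := by
    have := hart N
    exact hfg.ext_eq_zero_of_two_le hr (hreg.ext_seqQuot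
      (fun i hi => (hNN i (by omega)).mp (ha i hi)) le_rfl)
  have hlayN : HasLayers I s l N := hs.hasLayers hcog (hNB 0)
  have hlayR : HasLayers I s l R := hs.hasLayers hcog (hRB 0)
  obtain ⟨eN⟩ := exists_equiv_modQuot hsurjC hC N
  have hbc := fun (X : Type u) [AddCommGroup X] [Module R X] [Module C X] [IsScalarTower R C X]
      (i : ℕ) => ext_baseChange_iff hsurjC hs hC hcog X i N hNB
  have hfinal := hSAC (C ⊗[R] N)
    (fun i hi => by
      obtain ⟨i, rfl⟩ := Nat.exists_eq_add_one_of_ne_zero hi.ne'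
      exact (hbc C i).mp (ModExt.congr_right eC (hlayR.ext_eq_zero (hNB' _ hi))))
    ⟨a, fun i hi => by
      obtain ⟨i, rfl⟩ := Nat.exists_eq_add_one_of_ne_zero (by omega : i ≠ 0)
      exact (hbc (C ⊗[R] N) i).mp (ModExt.congr_right eN (hlayN.ext_eq_zero (hNI _ hi)))⟩
  have hNpow : ∀ i, 0 < i → Subsingleton (ModExt R N (ModQuot (I ^ l) N) i) := by
    intro i hi
    obtain ⟨i, rfl⟩ := Nat.exists_eq_add_one_of_ne_zero hi.ne'
    exact ModExt.congr_right eN.symm ((hbc (C ⊗[R] N) i).mpr (hfinal _ hi))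
  -- downward induction from the range where the vanishing is already known
  have hNI' : ∀ k i, 0 < i → a < i + k → Subsingleton (ModExt R N (ModQuot I N) i) := by
    intro k
    induction k with
    | zero => intro i _ hi; exact hNI i hi
    | succ k ih =>
      intro i hi hk
      exact hlayN.ext_descend hl (hNpow i hi) (ih (i + 1) (by omega) (by omega))
  intro i hi
  refine (hNN i hi).mpr (hreg.ext_of_seqQuot hxm ?_)
  have h1 := hNI' (a + 1) i hi (by omega)
  exact hfg.ext_mid (ModExt.subsingleton_pi h1) h1

end Transfer

/-! ### Ulrich ideals -/

section Ulrich

variable {R : Type u} [CommRing R]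

theorem IsRelBasis.map_mk {I K K' L : Ideal R} {ι : Type} [Fintype ι] {u : ι → R}
    (h : IsRelBasis I K K' u) (hL : L ≤ K') :
    IsRelBasis (I.map (Ideal.Quotient.mk L)) (K.map (Ideal.Quotient.mk L))
      (K'.map (Ideal.Quotient.mk L)) (Ideal.Quotient.mk L ∘ u) where
  mul_le := by rw [← Ideal.map_mul]; exact Ideal.map_mono h.mul_le
  span_sup := by
    conv_rhs => rw [← h.span_sup]
    rw [Ideal.map_sup, Ideal.map_span, Set.range_comp]
  indep a ha i := by
    choose c hc using fun i => Ideal.Quotient.mk_surjective (a i)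
    obtain rfl : (fun i => Ideal.Quotient.mk L (c i)) = a := funext hc
    have h1 : ∑ i, Ideal.Quotient.mk L (c i) * (Ideal.Quotient.mk L ∘ u) i =
        Ideal.Quotient.mk L (∑ i, c i * u i) := by simp
    rw [h1, Ideal.mem_quotient_iff_mem hL] at ha
    exact Ideal.mem_map_of_mem _ (h.indep c ha i)

theorem HasFreeLayers.map_mk {I : Ideal R} {s : ℕ → ℕ} {l : ℕ} (h : HasFreeLayers I s l) :
    HasFreeLayers (I.map (Ideal.Quotient.mk (I ^ l))) s l := by
  intro j hj
  obtain ⟨u, hu⟩ := h j hj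
  refine ⟨Ideal.Quotient.mk (I ^ l) ∘ u, ?_⟩
  rw [← Ideal.map_pow, ← Ideal.map_pow]
  exact hu.map_mk (Ideal.pow_le_pow_right hj)

/-- The rank of `I^j / I^{j+1}` over `R / I`, for an Ulrich ideal `I` with `I / Q` of rank `r` in a
ring of dimension `n`. -/
def layerRank (n r : ℕ) : ℕ → ℕ
  | 0 => 1
  | j + 1 => Nat.multichoose n (j + 1) + r * Nat.multichoose n j

theorem hasFreeLayers_of_regular {x : ℕ → R} {n : ℕ} (hx : IsRegularOn x n R) {I : Ideal R}
    (hI : I ^ 2 = seqIdeal x n * I) {r : ℕ} {v : Fin r → R}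
    (hv : IsRelBasis I I (seqIdeal x n) v) (l : ℕ) : HasFreeLayers I (layerRank n r) l := by
  intro j _
  cases j with
  | zero =>
    rw [zero_add, pow_one, pow_zero, Ideal.one_eq_top]
    exact ⟨_, (isRelBasis_one I).reindex (finOneEquiv)⟩
  | succ j => exact exists_relBasis_pow hx hI hv j

theorem sum_layerRank_lt {n r j : ℕ} (h : j + 2 ≤ n) :
    ∑ k ∈ Finset.range (j + 1), layerRank n r k < layerRank n r (j + 1) := by
  rw [Finset.sum_range_succ', add_comm]
  exact rank_lt n r j h

theorem isArtinianRing_quotient_of_radical_eq [IsLocalRing R] [IsNoetherianRing R] {I : Ideal R}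
    (hI : I.radical = IsLocalRing.maximalIdeal R) : IsArtinianRing (R ⧸ I) := by
  rw [isArtinianRing_iff_isNoetherianRing_krullDimLE_zero]
  refine ⟨inferInstance, Ring.krullDimLE_zero_iff.mpr fun P hP => ?_⟩
  have h1 : I ≤ P.comap (Ideal.Quotient.mk I) := fun a ha => by
    rw [Ideal.mem_comap, Ideal.Quotient.eq_zero_iff_mem.mpr ha]
    exact zero_mem _
  have hprime : (P.comap (Ideal.Quotient.mk I)).IsPrime := Ideal.comap_isPrime _ _
  have h2 : IsLocalRing.maximalIdeal R ≤ P.comap (Ideal.Quotient.mk I) := by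
    rw [← hI]
    exact hprime.radical_le_iff.mpr h1
  have h3 : (P.comap (Ideal.Quotient.mk I)).IsMaximal := by
    rw [← (IsLocalRing.maximalIdeal.isMaximal R).eq_of_le hprime.ne_top h2]
    exact IsLocalRing.maximalIdeal.isMaximal R
  have h4 := Ideal.map_comap_of_surjective _ Ideal.Quotient.mk_surjective P
  rw [← h4]
  exact Ideal.IsMaximal.map_of_surjective_of_ker_le Ideal.Quotient.mk_surjective (by rwa [Ideal.mk_ker])

/-- In a Cohen–Macaulay local ring of dimension `n`, a parameter ideal is generated by a regular
sequence of length `n`. -/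
theorem IsCohenMacaulayLocal.exists_isRegularOn [IsLocalRing R] (hR : IsCohenMacaulayLocal R)
    {n : ℕ} (hn : ringKrullDim R = (n : WithBot ℕ∞)) {Q : Ideal R} (hQ : IsParameterIdeal Q) :
    ∃ x : ℕ → R, seqIdeal x n = Q ∧ (∀ k < n, x k ∈ IsLocalRing.maximalIdeal R) ∧
      IsRegularOn x n R := by
  have := hR.isNoetherianRing
  obtain ⟨d, y, hd, hQy, hrad⟩ := hQ
  obtain rfl : d = n := by
    rw [hn] at hd
    exact_mod_cast hd.symm
  obtain ⟨rs, hreg, hlen⟩ := hR.exists_isRegular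
  obtain rfl : rs.length = d := by
    rw [hn] at hlen
    exact_mod_cast hlen.symm
  let x : ℕ → R := fun k => if h : k < rs.length then y ⟨k, h⟩ else 0
  have hxQ : seqIdeal x rs.length = Q := by
    rw [hQy, seqIdeal]
    congr 1
    ext z
    constructor
    · rintro ⟨k, hk, rfl⟩
      exact ⟨⟨k, hk⟩, by simp [x, show k < rs.length from hk]⟩
    · rintro ⟨k, rfl⟩
      exact ⟨k, k.2, by simp [x]⟩
  have hxm : ∀ k < rs.length, x k ∈ IsLocalRing.maximalIdeal R := fun k hk => by
    rw [← hrad, ← hxQ]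
    exact Ideal.le_radical (mem_seqIdeal x hk)
  refine ⟨x, hxQ, hxm, isRegularOn_of_depth hxm (by rw [hxQ, hrad]) ?_⟩
  refine ext_residue_eq_zero_of_isWeaklyRegular rs (fun r hr => ?_) R hreg.toIsWeaklyRegular
  have hne : Ideal.ofList rs ≠ ⊤ := fun h => hreg.top_ne_smul (by rw [h]; simp)
  exact IsLocalRing.le_maximalIdeal hne (Ideal.subset_span hr)

end Ulrich

theorem theorem4p6 (R : Type u) [CommRing R] [IsLocalRing R] (hR : IsCohenMacaulayLocal R)
    (n : ℕ) (hn : ringKrullDim R = (n : WithBot ℕ∞))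
    (I : Ideal R) (hI : IsUlrichIdeal I) (hG : IsGorensteinLocal (R ⧸ I)) :
    (SatisfiesSAC (R ⧸ I) → 2 ≤ n →
      ∀ l : ℕ, 2 ≤ l → l ≤ n → SatisfiesSAC (R ⧸ I ^ l)) ∧
    ((∃ l : ℕ, 0 < l ∧ SatisfiesSAC (R ⧸ I ^ l)) → 1 < (I.spanFinrank : ℤ) - (n : ℤ) →
      SatisfiesSAC R) := by
  have := hR.isNoetherianRing
  have := hG.isLocalRing
  have := hI.free
  have : IsArtinianRing (R ⧸ I) := isArtinianRing_quotient_of_radical_eq hI.radical_eq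
  have : Module.Injective (R ⧸ I) (R ⧸ I) :=
    injective_self_of_artinian hG.exists_hasInjectiveDimensionLE
  obtain ⟨Q, hQ, hQI, hsq⟩ := hI.exists_parameter
  obtain ⟨x, rfl, hxm, hx⟩ := hR.exists_isRegularOn hn hQ
  obtain ⟨r, v, hv, hrank⟩ := exists_relBasis_parameter hx hQI hsq
  have hlay := hasFreeLayers_of_regular hx hsq hv
  constructor
  · intro hSAC _ l hl hln
    obtain ⟨j, rfl⟩ := Nat.exists_eq_add_of_le hl
    rw [add_comm 2 j] at hln ⊢
    have hle : I ^ (j + 2) ≤ I := Ideal.pow_le_self (by omega)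
    let _ : Algebra (R ⧸ I ^ (j + 2)) (R ⧸ I) := (Ideal.Quotient.factor hle).toAlgebra
    have hker : RingHom.ker (algebraMap (R ⧸ I ^ (j + 2)) (R ⧸ I)) =
        I.map (Ideal.Quotient.mk (I ^ (j + 2))) := Ideal.Quotient.factor_ker hle
    refine SatisfiesSAC.of_quotient (B := R ⧸ I) (Ideal.Quotient.factor_surjective hle) hker
      (hlay (j + 2)).map_mk ?_ (sum_layerRank_lt hln) hSAC
    rw [← Ideal.map_pow, Ideal.map_quotient_self]
  · rintro ⟨l, hl, hSAC⟩ hmu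
    exact SatisfiesSAC.of_quotient_pow (B := R ⧸ I) Ideal.Quotient.mk_surjective Ideal.mk_ker hx hxm
      (by omega) hv hl (hlay l) Ideal.Quotient.mk_surjective Ideal.mk_ker hSAC
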